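/- Let $n\ge 2$, $k>0$ and let $\mathbb H^n(-k)$ be the hyperbolic $n$-space of constant sectional curvature $-k$, with Laplace--Beltrami operator $\Delta$. Let $\lambda>\frac{(n-1)^2k}{4}$. There is a unique radius $R_{\lambda,n}>0$ (depending only on $n,k,\lambda$) such that the first Dirichlet eigenvalue of the Laplacian on the geodesic balls of radius $R_{\lambda,n}$ in $\mathbb H^n(-k)$, whatever their center, equals $\lambda$. Here the first Dirichlet eigenvalue of a ball $B$ is the least $\mu$ for which $\Delta v+\mu v=0$ in $B$, $v=0$ on $\partial B$, has a nontrivial solution $v\in C^2(B)\cap C^0(\overline B)$. This radius has the following property. Let $\Omega\subset\mathbb H^n(-k)$ be an open connected (bounded or unbounded) domain, let $f:(0,+\infty)\to\mathbb R$ satisfy $f(t)\ge\lambda t$ for all $t>0$, and let $u\in C^2(\Omega)$ be a strictly positive function with $$\Delta u+f(u)=0\quad\text{in }\Omega .$$ Then $\Omega$ does not contain any closed geodesic ball of radius $R_{\lambda,n}$. Moreover, if $\partial\Omega$ is of class $C^2$, with outward unit normal $\vec v$, and $u$ is differentiable up to the boundary and satisfies $$u=0\quad\text{and}\quad \langle\nabla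 u,\vec v\rangle=\alpha\qquad\text{on }\partial\Omega$$ for some constant $\alpha<0$, then either $\overline\Omega$ does not contain any closed geodesic ball of radius $R_{\lambda,n}$, or $\Omega$ is a geodesic ball of radius $R_{\lambda,n}$. -/

import Mathlib

open scoped InnerProductSpace Topology

noncomputable section

/-- The hyperbolic `n`-space `ℍⁿ(-k)` in the hyperboloid model. The sheet
`{(x₀, x) : x₀ ^ 2 - ‖x‖ ^ 2 = 1, x₀ > 0}` is a graph over `ℝⁿ`, and its points are recorded by the
global coordinate `x ∈ ℝⁿ`, with `x₀ = √(1 + ‖x‖ ^ 2)`. The topology and the smooth structure of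
`ℍⁿ(-k)` are those of `ℝⁿ`; the Riemannian metric and the distance are defined below. -/
abbrev HypSpace (n : ℕ) : Type := EuclideanSpace ℝ (Fin n)

namespace HypSpace

variable {n : ℕ}

/-- The Riemannian metric of constant curvature `-k` at `x`, on tangent vectors `ξ`, `η` expressed
in the coordinate `x`: `1 / k` times the restriction of the Minkowski form `⟪dx, dx⟫ - dx₀ ^ 2`
to the hyperboloid, where `dx₀ ξ = ⟪x, ξ⟫ / √(1 + ‖x‖ ^ 2)`. -/
def metric (k : ℝ) (x ξ η : HypSpace n) : ℝ :=
  k⁻¹ * (⟪ξ, η⟫_ℝ - ⟪x, ξ⟫_ℝ * ⟪x, η⟫_ℝ / (1 + ‖x‖ ^ 2))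

/-- The hyperbolic distance of `ℍⁿ(-k)`: `cosh (√k d(x, y)) = x₀ y₀ - ⟪x, y⟫`. -/
def hdist (k : ℝ) (x y : HypSpace n) : ℝ :=
  Real.arcosh (√(1 + ‖x‖ ^ 2) * √(1 + ‖y‖ ^ 2) - ⟪x, y⟫_ℝ) / √k

/-- The open geodesic ball of radius `R` about `p`. -/
def geodesicBall (k : ℝ) (p : HypSpace n) (R : ℝ) : Set (HypSpace n) :=
  {x | hdist k p x < R}

/-- The closed geodesic ball of radius `R` about `p`. -/
def closedGeodesicBall (k : ℝ) (p : HypSpace n) (R : ℝ) : Set (HypSpace n) :=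
  {x | hdist k p x ≤ R}

/-- The `i`-th coordinate vector field. -/
def coordVec (i : Fin n) : HypSpace n := EuclideanSpace.single i (1 : ℝ)

/-- The matrix `(g_{ij})` of the metric in the coordinate `x`. -/
def gram (k : ℝ) (x : HypSpace n) : Matrix (Fin n) (Fin n) ℝ :=
  Matrix.of fun i j => metric k x (coordVec i) (coordVec j)

/-- The density `√(det g_{ij})` of the Riemannian volume in the coordinate `x`. -/
def volDensity (k : ℝ) (x : HypSpace n) : ℝ := √((gram k x).det)

/-- The tangent vector `g^{ij} L_j` at `x` that is dual to the covector `L` by the metric. -/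
def sharp (k : ℝ) (x : HypSpace n) (L : HypSpace n →L[ℝ] ℝ) : HypSpace n :=
  WithLp.toLp 2 (Matrix.mulVec (gram k x)⁻¹ fun j => L (coordVec j))

/-- The Riemannian gradient of `u`. -/
def grad (k : ℝ) (u : HypSpace n → ℝ) (x : HypSpace n) : HypSpace n :=
  sharp k x (fderiv ℝ u x)

/-- The Riemannian divergence `(det g)^{-1/2} ∂_i ((det g)^{1/2} X^i)` of a vector field `X`. -/
def divergence (k : ℝ) (X : HypSpace n → HypSpace n) (x : HypSpace n) : ℝ :=
  (volDensity k x)⁻¹ * ∑ i, fderiv ℝ (fun y => volDensity k y * X y i) x (coordVec i)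

/-- The Laplace-Beltrami operator of `ℍⁿ(-k)`. -/
def laplacian (k : ℝ) (u : HypSpace n → ℝ) (x : HypSpace n) : ℝ :=
  divergence k (grad k u) x

/-- `μ` is an eigenvalue of the Dirichlet problem `Δv + μv = 0` in `D`, `v = 0` on `∂D`. -/
def IsDirichletEigenvalue (k : ℝ) (D : Set (HypSpace n)) (μ : ℝ) : Prop :=
  ∃ v : HypSpace n → ℝ,
    ContDiffOn ℝ 2 v D ∧ ContinuousOn v (closure D) ∧ (∃ x ∈ D, v x ≠ 0) ∧
    (∀ x ∈ D, laplacian k v x + μ * v x = 0) ∧ (∀ x ∈ frontier D, v x = 0)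

/-- `μ` is the first (that is, the least) Dirichlet eigenvalue of the Laplacian on `D`. -/
def IsFirstDirichletEigenvalue (k : ℝ) (D : Set (HypSpace n)) (μ : ℝ) : Prop :=
  IsLeast {μ' | IsDirichletEigenvalue k D μ'} μ

/-- `φ` is a `C²` defining function of `Ω` near the boundary point `q`: near `q` the set `Ω` is
`{φ < 0}`, and `dφ ≠ 0` at `q`. -/
def IsDefiningFunctionAt (Ω : Set (HypSpace n)) (q : HypSpace n) (φ : HypSpace n → ℝ) : Prop :=
  ContDiffAt ℝ 2 φ q ∧ fderiv ℝ φ q ≠ 0 ∧ ∀ᶠ x in 𝓝 q, (x ∈ Ω ↔ φ x < 0)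

/-- The boundary of `Ω` is of class `C²`. -/
def HasC2Boundary (Ω : Set (HypSpace n)) : Prop :=
  ∀ q ∈ frontier Ω, ∃ φ, IsDefiningFunctionAt Ω q φ

/-- `ν` is the outward unit normal vector of `∂Ω` at `q`, that is, `∇φ / |∇φ|` for a defining
function `φ`; gradient and length are those of the hyperbolic metric. -/
def IsOutwardUnitNormal (k : ℝ) (Ω : Set (HypSpace n)) (q ν : HypSpace n) : Prop :=
  metric k q ν ν = 1 ∧
    ∃ φ, IsDefiningFunctionAt Ω q φ ∧ ∃ c : ℝ, 0 < c ∧ ν = c • grad k φ q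

/-- `u` is differentiable up to the boundary, `u = 0` and `⟨∇u, ν⟩ = α` on `∂Ω`, where `ν` is the
outward unit normal. At a boundary point `∇u` is the gradient of `u` as a function on the
closure of `Ω`. -/
def OverdeterminedBoundary (k : ℝ) (Ω : Set (HypSpace n)) (u : HypSpace n → ℝ) (α : ℝ) : Prop :=
  ∀ q ∈ frontier Ω, u q = 0 ∧ DifferentiableWithinAt ℝ u (closure Ω) q ∧
    ∀ ν, IsOutwardUnitNormal k Ω q ν →
      metric k q (sharp k q (fderivWithin ℝ u (closure Ω) q)) ν = α

end HypSpace

end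

/-! ### The metric and the Laplacian in the global coordinate. -/

namespace HypSpace

open Filter Set

variable {n : ℕ}

/-! For a radial function F(y) with y = cosh(√k d(p, ·)) - 1, the equation Δv + kLv = 0 becomes y(y
+ 2)F'' + n(1 + y)F' + LF = 0, whatever the center p. Let `sol` be the regular solution with F(0) =
1. For L = λ/k > (n - 1)²/4 it has a zero: otherwise the Riccati variable -(1 + y)F'/F would have an
unbounded arctangent (`exists_nonpos`). If Y is the first zero, R is defined by cosh(√k R) = 1 + Y.

Since f(u) ≥ λu, the function u is a positive supersolution of Δ + λ. The basic tool is
`nonpos_of_comparison`: at a positive interior maximum of a quotient v/u, the difference v - Mu has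
a local maximum, so its Laplacian is nonpositive there. Perturbations of `sol`, made strict sub- or
supersolutions, then decide everything about balls. Smaller balls do not have the eigenvalue λ,
larger ones have a smaller eigenvalue, and the ball of radius R has none below λ
(`isFirstDirichletEigenvalue_iff`). A closed ball of radius R in Ω could be enlarged inside Ω to
where the radial solution is negative, which contradicts comparison with u
(`not_closedBall_subset`).

If only the closure of Ω contains the closed ball, C² regularity of the boundary puts the open ball
in Ω. Take the largest t with tv ≤ u on the ball, v being the radial eigenfunction. Either u - tv
vanishes somewhere, hence identically by the strong maximum principle, or a thin-annulus maximum
principle allows t to be increased. So u = 0 on the sphere (`eq_zero_on_sphere`); the sphere misses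
Ω, and connectedness makes Ω the ball. -/

theorem metric_coordVec (k : ℝ) (x : HypSpace n) (i j : Fin n) :
    metric k x (coordVec i) (coordVec j) =
      k⁻¹ * ((if i = j then 1 else 0) - x i * x j / (1 + ‖x‖ ^ 2)) := by
  simp [metric, coordVec, EuclideanSpace.inner_single_right, eq_comm]

theorem norm_sq_eq_sum (x : HypSpace n) : ‖x‖ ^ 2 = ∑ i, x i * x i := by
  rw [EuclideanSpace.norm_sq_eq]
  simp [pow_two]

theorem clm_eq_sum (L : HypSpace n →L[ℝ] ℝ) (x : HypSpace n) :
    L x = ∑ i, x i * L (coordVec i) := by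
  have hx : x = ∑ i, x i • (coordVec i : HypSpace n) := by
    ext j
    simp [coordVec, Pi.single_apply]
  conv_lhs => rw [hx]
  simp

/-- The Gram matrix is k⁻¹(I - xxᵀ/(1 + ‖x‖²)), a rank-one perturbation of a scalar matrix, so
Sherman–Morrison inverts it. -/
theorem gram_inv {k : ℝ} (hk : 0 < k) (x : HypSpace n) :
    (gram k x)⁻¹ = Matrix.of fun i j => k * ((if i = j then 1 else 0) + x i * x j) := by
  apply Matrix.inv_eq_right_inv
  ext i j
  have hq : (1 + ‖x‖ ^ 2) ≠ 0 := by positivity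
  simp only [gram, Matrix.mul_apply, Matrix.of_apply, metric_coordVec]
  have : ∀ l, k⁻¹ * ((if i = l then 1 else 0) - x i * x l / (1 + ‖x‖ ^ 2)) *
      (k * ((if l = j then 1 else 0) + x l * x j)) =
      (if i = l then (if l = j then 1 else 0) else 0) + (if i = l then x l * x j else 0)
      - (if l = j then x i * x l / (1 + ‖x‖ ^ 2) else 0)
      - x i * x j / (1 + ‖x‖ ^ 2) * (x l * x l) := by
    intro l
    have : k⁻¹ * k = 1 := inv_mul_cancel₀ hk.ne'
    rw [mul_mul_mul_comm, this]
    split_ifs <;> ring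
  simp only [this, Finset.sum_sub_distrib, Finset.sum_add_distrib, Finset.sum_ite_eq,
    Finset.sum_ite_eq', Finset.mem_univ, if_true, ← Finset.mul_sum, ← norm_sq_eq_sum]
  rw [Matrix.one_apply]
  field_simp
  ring

theorem gram_det (k : ℝ) (x : HypSpace n) :
    (gram k x).det = k⁻¹ ^ n * (1 + ‖x‖ ^ 2)⁻¹ := by
  have hq : (1 + ‖x‖ ^ 2) ≠ 0 := by positivity
  have h : gram k x = k⁻¹ • (1 + Matrix.replicateCol Unit (fun i => -(x i) / (1 + ‖x‖ ^ 2)) *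
      Matrix.replicateRow Unit (fun i => x i)) := by
    ext i j
    simp only [gram, Matrix.of_apply, metric_coordVec, Matrix.smul_apply, Matrix.add_apply,
      Matrix.one_apply, Matrix.mul_apply, Matrix.replicateCol_apply, Matrix.replicateRow_apply,
      Finset.univ_unique, Finset.sum_const, Finset.card_singleton, smul_eq_mul, one_smul]
    ring
  rw [h, Matrix.det_smul, Matrix.det_one_add_replicateCol_mul_replicateRow]
  simp only [Fintype.card_fin, dotProduct]
  congr 1
  have : ∀ i, x i * (-(x i) / (1 + ‖x‖ ^ 2)) = -(1 + ‖x‖ ^ 2)⁻¹ * (x i * x i) := by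
    intro i; ring
  simp only [this, ← Finset.mul_sum, ← norm_sq_eq_sum]
  field_simp
  ring

theorem volDensity_eq {k : ℝ} (hk : 0 < k) (x : HypSpace n) :
    volDensity k x = √(k⁻¹ ^ n) * (√(1 + ‖x‖ ^ 2))⁻¹ := by
  rw [volDensity, gram_det, Real.sqrt_mul (by positivity), Real.sqrt_inv (1 + ‖x‖ ^ 2)]

theorem grad_apply {k : ℝ} (hk : 0 < k) (u : HypSpace n → ℝ) (x : HypSpace n) (i : Fin n) :
    grad k u x i = k * (fderiv ℝ u x (coordVec i) + fderiv ℝ u x x * x i) := by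
  simp only [grad, sharp, gram_inv hk, Matrix.mulVec, dotProduct, Matrix.of_apply]
  have : ∀ j, k * ((if i = j then 1 else 0) + x i * x j) * fderiv ℝ u x (coordVec j) =
      (if i = j then k * fderiv ℝ u x (coordVec j) else 0) +
        k * x i * (x j * fderiv ℝ u x (coordVec j)) := by
    intro j; split_ifs <;> ring
  simp only [this, Finset.sum_add_distrib, Finset.sum_ite_eq, Finset.mem_univ, if_true,
    ← Finset.mul_sum, ← clm_eq_sum]
  ring

theorem hasFDerivAt_sqrt_inv (x : HypSpace n) :
    HasFDerivAt (fun y : HypSpace n => (√(1 + ‖y‖ ^ 2))⁻¹)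
      ((-(1 + ‖x‖ ^ 2)⁻¹ * (√(1 + ‖x‖ ^ 2))⁻¹) • innerSL ℝ x) x := by
  have hq : (0 : ℝ) < 1 + ‖x‖ ^ 2 := by positivity
  have h1 : HasFDerivAt (fun y : HypSpace n => 1 + ‖y‖ ^ 2) (2 • innerSL ℝ x) x :=
    (hasStrictFDerivAt_norm_sq x).hasFDerivAt.const_add 1
  have h2 := (h1.sqrt hq.ne')
  have hs : √(1 + ‖x‖ ^ 2) ≠ 0 := by positivity
  have h3 := (hasDerivAt_inv hs).comp_hasFDerivAt x h2
  refine h3.congr_fderiv ?_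
  rw [← Nat.cast_smul_eq_nsmul ℝ, smul_smul, smul_smul, Real.sq_sqrt hq.le]
  congr 1
  push_cast
  field_simp

/-- The Laplacian in coordinates. -/
theorem laplacian_eq {k : ℝ} (hk : 0 < k) {u : HypSpace n → ℝ} {x : HypSpace n}
    (hu : ContDiffAt ℝ 2 u x) :
    laplacian k u x = k * (∑ i, fderiv ℝ (fderiv ℝ u) x (coordVec i) (coordVec i) +
      fderiv ℝ (fderiv ℝ u) x x x + n * fderiv ℝ u x x) := by
  have hd : HasFDerivAt (fderiv ℝ u) (fderiv ℝ (fderiv ℝ u) x) x :=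
    ((hu.fderiv_right (m := 1) (by norm_num)).differentiableAt (by norm_num)).hasFDerivAt
  set D := fderiv ℝ (fderiv ℝ u) x with hD
  have hq : (0 : ℝ) < 1 + ‖x‖ ^ 2 := by positivity
  have ha : 0 < √(k⁻¹ ^ n) := by positivity
  have hs : 0 < √(1 + ‖x‖ ^ 2) := by positivity
  have key : ∀ i, fderiv ℝ (fun y => volDensity k y * grad k u y i) x (coordVec i) =
      √(k⁻¹ ^ n) * (√(1 + ‖x‖ ^ 2))⁻¹ * k * (D (coordVec i) (coordVec i) +
        x i * D (coordVec i) x + x i * fderiv ℝ u x (coordVec i) + fderiv ℝ u x x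
        - (1 + ‖x‖ ^ 2)⁻¹ * (x i * fderiv ℝ u x (coordVec i) + fderiv ℝ u x x * (x i * x i))) := by
    intro i
    have e : (fun y => volDensity k y * grad k u y i) = fun y => √(k⁻¹ ^ n) *
        ((√(1 + ‖y‖ ^ 2))⁻¹ * (k * (fderiv ℝ u y (coordVec i) + fderiv ℝ u y y * y i))) := by
      funext y
      rw [volDensity_eq hk, grad_apply hk]; ring
    rw [e]
    have h1 := hd.clm_apply (hasFDerivAt_const (coordVec i : HypSpace n) x)
    have h2 := hd.clm_apply (hasFDerivAt_id x)
    have h3 : HasFDerivAt (fun y : HypSpace n => y i)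
      (EuclideanSpace.proj i : HypSpace n →L[ℝ] ℝ) x :=
      (EuclideanSpace.proj i : HypSpace n →L[ℝ] ℝ).hasFDerivAt
    have h4 := ((hasFDerivAt_sqrt_inv x).mul ((h1.add (h2.mul h3)).const_mul k)).const_mul
      (√(k⁻¹ ^ n))
    have h5 := h4.fderiv
    simp only [Pi.mul_apply, Pi.add_apply, id] at h5
    erw [h5]
    have e1 : (coordVec i : HypSpace n) i = 1 := by simp [coordVec]
    have e2 : inner ℝ x (coordVec i) = x i := by
      simp [coordVec, EuclideanSpace.inner_single_right]
    simp [e1, e2]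
    ring
  have hDx : D x x = ∑ i, x i * D (coordVec i) x := by
    have := clm_eq_sum (D.flip x) x
    simpa using this
  have h1 := clm_eq_sum (fderiv ℝ u x) x
  rw [laplacian, divergence, volDensity_eq hk]
  simp only [key, ← Finset.mul_sum, Finset.sum_add_distrib, Finset.sum_sub_distrib, ← h1, ← hDx,
    ← norm_sq_eq_sum, Finset.sum_const, Finset.card_univ, Fintype.card_fin, nsmul_eq_mul]
  field_simp
  ring

end HypSpace

/-! ### Second derivatives along lines and Laplacians of radial functions. -/

namespace HypSpace

open Filter Set

variable {n : ℕ}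

theorem hasDerivAt_line (x ξ : HypSpace n) (t : ℝ) :
    HasDerivAt (fun t : ℝ => x + t • ξ) ξ t := by
  simpa using ((hasDerivAt_id t).smul_const ξ).const_add x

theorem tendsto_line (x ξ : HypSpace n) : Tendsto (fun t : ℝ => x + t • ξ) (𝓝 0) (𝓝 x) := by
  have := (hasDerivAt_line x ξ 0).continuousAt.tendsto
  simpa using this

theorem eventually_hasDerivAt_line {u : HypSpace n → ℝ} {x : HypSpace n}
    (hu : ContDiffAt ℝ 2 u x) (ξ : HypSpace n) :
    ∀ᶠ t in 𝓝 (0 : ℝ), HasDerivAt (fun t : ℝ => u (x + t • ξ)) (fderiv ℝ u (x + t • ξ) ξ) t := by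
  have h1 : ∀ᶠ y in 𝓝 x, DifferentiableAt ℝ u y :=
    (hu.eventually (by simp)).mono fun y hy => hy.differentiableAt (by norm_num)
  filter_upwards [(tendsto_line x ξ).eventually h1] with t ht
  exact ht.hasFDerivAt.comp_hasDerivAt t (hasDerivAt_line x ξ t)

theorem hasFDerivAt_fderiv {u : HypSpace n → ℝ} {x : HypSpace n} (hu : ContDiffAt ℝ 2 u x) :
    HasFDerivAt (fderiv ℝ u) (fderiv ℝ (fderiv ℝ u) x) x :=
  ((hu.fderiv_right (m := 1) (by norm_num)).differentiableAt (by norm_num)).hasFDerivAt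

theorem hasDerivAt_fderiv_line {u : HypSpace n → ℝ} {x : HypSpace n}
    (hu : ContDiffAt ℝ 2 u x) (ξ : HypSpace n) :
    HasDerivAt (fun t : ℝ => fderiv ℝ u (x + t • ξ) ξ) (fderiv ℝ (fderiv ℝ u) x ξ ξ) 0 := by
  have h : HasFDerivAt (fderiv ℝ u) (fderiv ℝ (fderiv ℝ u) x) (x + (0 : ℝ) • ξ) := by
    simpa using hasFDerivAt_fderiv hu
  have h2 : HasDerivAt (fun t : ℝ => fderiv ℝ u (x + t • ξ)) (fderiv ℝ (fderiv ℝ u) x ξ) 0 :=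
    h.comp_hasDerivAt (0 : ℝ) (hasDerivAt_line x ξ 0)
  exact ((ContinuousLinearMap.apply ℝ ℝ ξ).hasFDerivAt.comp_hasDerivAt (0 : ℝ) h2)

/-- The formula `laplacian_eq` involves the Hessian only on its diagonal, so one-variable calculus
along lines is enough to compute it. -/
theorem fderiv_eq_of_line {u : HypSpace n → ℝ} {x ξ : HypSpace n} {g : ℝ → ℝ} {b : ℝ}
    (hu : ContDiffAt ℝ 2 u x)
    (h1 : ∀ t, HasDerivAt (fun t : ℝ => u (x + t • ξ)) (g t) t) (h2 : HasDerivAt g b 0) :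
    fderiv ℝ u x ξ = g 0 ∧ fderiv ℝ (fderiv ℝ u) x ξ ξ = b := by
  have h3 : (fun t : ℝ => fderiv ℝ u (x + t • ξ) ξ) =ᶠ[𝓝 0] g := by
    filter_upwards [eventually_hasDerivAt_line hu ξ] with t ht
    exact ht.unique (h1 t)
  refine ⟨by simpa using h3.eq_of_nhds, ?_⟩
  exact (hasDerivAt_fderiv_line hu ξ).unique (h2.congr_of_eventuallyEq h3)

/-- A positive second derivative along a line would make the point a local minimum as well; the
restriction would then be locally constant, with zero second derivative. -/
theorem _root_.IsLocalMax.fderiv_fderiv_nonpos {u : HypSpace n → ℝ} {x : HypSpace n}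
    (hu : ContDiffAt ℝ 2 u x) (hm : IsLocalMax u x) (ξ : HypSpace n) :
    fderiv ℝ (fderiv ℝ u) x ξ ξ ≤ 0 := by
  by_contra! hpos
  set g : ℝ → ℝ := fun t => u (x + t • ξ) with hg
  have h1 : deriv g =ᶠ[𝓝 0] fun t => fderiv ℝ u (x + t • ξ) ξ := by
    filter_upwards [eventually_hasDerivAt_line hu ξ] with t ht using ht.deriv
  have h2 : deriv (deriv g) 0 = fderiv ℝ (fderiv ℝ u) x ξ ξ :=
    h1.deriv_eq.trans (hasDerivAt_fderiv_line hu ξ).deriv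
  have hmax : IsLocalMax g 0 := by
    have := (tendsto_line x ξ).eventually hm
    simpa [IsLocalMax, IsMaxFilter, hg] using this
  have hmin : IsLocalMin g 0 := isLocalMin_of_deriv_deriv_pos (by rw [h2]; exact hpos)
    hmax.deriv_eq_zero (eventually_hasDerivAt_line hu ξ).self_of_nhds.continuousAt
  have hc : g =ᶠ[𝓝 0] fun _ => g 0 := by
    filter_upwards [hmax, hmin] with t ha hb using le_antisymm ha hb
  have h3 : deriv g =ᶠ[𝓝 0] fun _ => 0 := by
    filter_upwards [hc.deriv] with t ht
    simpa using ht
  have h4 : deriv (deriv g) 0 = 0 := by simpa using h3.deriv_eq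
  linarith

theorem laplacian_nonpos_of_isLocalMax {k : ℝ} (hk : 0 < k) {u : HypSpace n → ℝ} {x : HypSpace n}
    (hu : ContDiffAt ℝ 2 u x) (hm : IsLocalMax u x) : laplacian k u x ≤ 0 := by
  rw [laplacian_eq hk hu, hm.fderiv_eq_zero]
  have h1 := Finset.sum_nonpos (s := Finset.univ)
    (f := fun i => fderiv ℝ (fderiv ℝ u) x (coordVec i) (coordVec i))
    fun i _ => hm.fderiv_fderiv_nonpos hu (coordVec i)
  have h2 := hm.fderiv_fderiv_nonpos hu x
  refine mul_nonpos_of_nonneg_of_nonpos hk.le ?_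
  simp only [zero_apply, mul_zero, add_zero]
  linarith

theorem laplacian_lincomb {k : ℝ} (hk : 0 < k) {u v : HypSpace n → ℝ} {x : HypSpace n}
    (hu : ContDiffAt ℝ 2 u x) (hv : ContDiffAt ℝ 2 v x) (a b : ℝ) :
    laplacian k (fun y => a * u y + b * v y) x = a * laplacian k u x + b * laplacian k v x := by
  have h : ∀ {w : HypSpace n → ℝ}, ContDiffAt ℝ 2 w x → ∀ᶠ y in 𝓝 x, DifferentiableAt ℝ w y :=
    fun hw => (hw.eventually (by simp)).mono fun y hy => hy.differentiableAt (by norm_num)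
  have h1 : fderiv ℝ (fun y => a * u y + b * v y) =ᶠ[𝓝 x]
      fun y => a • fderiv ℝ u y + b • fderiv ℝ v y := by
    filter_upwards [h hu, h hv] with y h1 h2
    exact ((h1.hasFDerivAt.const_mul a).add (h2.hasFDerivAt.const_mul b)).fderiv
  have h2 : fderiv ℝ (fderiv ℝ fun y => a * u y + b * v y) x =
      a • fderiv ℝ (fderiv ℝ u) x + b • fderiv ℝ (fderiv ℝ v) x := by
    rw [h1.fderiv_eq]
    exact (((hasFDerivAt_fderiv hu).const_smul a).add ((hasFDerivAt_fderiv hv).const_smul b)).fderiv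
  rw [laplacian_eq hk hu, laplacian_eq hk hv,
    laplacian_eq hk ((contDiffAt_const.mul hu).add (contDiffAt_const.mul hv)), h2, h1.eq_of_nhds]
  simp only [add_apply, smul_apply, smul_eq_mul,
    Finset.sum_add_distrib, ← Finset.mul_sum]
  ring

/-- `cosh (√k d(p, x))`. -/
noncomputable def coshDist (p x : HypSpace n) : ℝ := √(1 + ‖p‖ ^ 2) * √(1 + ‖x‖ ^ 2) - ⟪p, x⟫_ℝ

theorem contDiff_sqrt_one_add : ContDiff ℝ 2 fun x : HypSpace n => √(1 + ‖x‖ ^ 2) :=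
  (contDiff_const.add (contDiff_norm_sq ℝ)).sqrt fun x => by positivity

theorem contDiff_coshDist (p : HypSpace n) : ContDiff ℝ 2 (coshDist p) :=
  (contDiff_const.mul contDiff_sqrt_one_add).sub (contDiff_const.inner ℝ contDiff_id)

theorem continuous_coshDist (p : HypSpace n) : Continuous (coshDist p) :=
  (contDiff_coshDist p).continuous

theorem hasDerivAt_coshDist_line (p x ξ : HypSpace n) (t : ℝ) :
    HasDerivAt (fun t : ℝ => coshDist p (x + t • ξ))
      (√(1 + ‖p‖ ^ 2) * ((⟪x, ξ⟫_ℝ + t * ‖ξ‖ ^ 2) / √(1 + ‖x + t • ξ‖ ^ 2)) - ⟪p, ξ⟫_ℝ) t := by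
  have h0 := hasDerivAt_line x ξ t
  have h1 : HasDerivAt (fun t : ℝ => 1 + ‖x + t • ξ‖ ^ 2) (2 * (⟪x, ξ⟫_ℝ + t * ‖ξ‖ ^ 2)) t := by
    have := h0.norm_sq.const_add 1
    rwa [inner_add_left, real_inner_smul_left, real_inner_self_eq_norm_sq] at this
  have h2 := ((h1.sqrt (by positivity)).const_mul (√(1 + ‖p‖ ^ 2))).sub
    ((hasDerivAt_const t p).inner ℝ h0)
  refine h2.congr_deriv ?_
  have : (0:ℝ) < √(1 + ‖x + t • ξ‖ ^ 2) := by positivity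
  simp only [inner_zero_left, add_zero]
  field_simp

theorem hasDerivAt_coshDist_line_deriv (p x ξ : HypSpace n) :
    HasDerivAt (fun t : ℝ => √(1 + ‖p‖ ^ 2) * ((⟪x, ξ⟫_ℝ + t * ‖ξ‖ ^ 2) / √(1 + ‖x + t • ξ‖ ^ 2))
        - ⟪p, ξ⟫_ℝ)
      (√(1 + ‖p‖ ^ 2) * (‖ξ‖ ^ 2 / √(1 + ‖x‖ ^ 2) - ⟪x, ξ⟫_ℝ ^ 2 / √(1 + ‖x‖ ^ 2) ^ 3)) 0 := by
  have h1 : HasDerivAt (fun t : ℝ => 1 + ‖x + t • ξ‖ ^ 2) (2 * (⟪x, ξ⟫_ℝ + 0 * ‖ξ‖ ^ 2)) 0 := by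
    have := (hasDerivAt_line x ξ 0).norm_sq.const_add 1
    rwa [inner_add_left, real_inner_smul_left, real_inner_self_eq_norm_sq] at this
  have h2 := h1.sqrt (by positivity)
  have h3 : HasDerivAt (fun t : ℝ => ⟪x, ξ⟫_ℝ + t * ‖ξ‖ ^ 2) (‖ξ‖ ^ 2) 0 := by
    simpa using ((hasDerivAt_id (0:ℝ)).mul_const (‖ξ‖ ^ 2)).const_add ⟪x, ξ⟫_ℝ
  have h4 := ((h3.div h2 (by positivity)).const_mul (√(1 + ‖p‖ ^ 2))).sub_const ⟪p, ξ⟫_ℝ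
  refine h4.congr_deriv ?_
  have : (0:ℝ) < √(1 + ‖x‖ ^ 2) := by positivity
  simp only [zero_smul, add_zero, zero_mul]
  field_simp

theorem sum_inner_coordVec (x y : HypSpace n) :
    ∑ i, ⟪x, coordVec i⟫_ℝ * ⟪y, coordVec i⟫_ℝ = ⟪x, y⟫_ℝ := by
  simp [coordVec, PiLp.inner_apply, mul_comm]

theorem norm_coordVec (i : Fin n) : ‖(coordVec i : HypSpace n)‖ = 1 := by
  simp [coordVec]

theorem contDiff_two_of_hasDerivAt {G G1 G2 : ℝ → ℝ} (h1 : ∀ y, HasDerivAt G (G1 y) y)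
    (h2 : ∀ y, HasDerivAt G1 (G2 y) y) (hc : Continuous G2) : ContDiff ℝ 2 G := by
  have e1 : deriv G = G1 := funext fun y => (h1 y).deriv
  have e2 : deriv G1 = G2 := funext fun y => (h2 y).deriv
  have : ContDiff ℝ 1 G1 :=
    contDiff_one_iff_deriv.2 ⟨fun y => (h2 y).differentiableAt, by rwa [e2]⟩
  have h : ContDiff ℝ (1 + 1) G := by
    rw [contDiff_succ_iff_deriv]
    exact ⟨fun y => (h1 y).differentiableAt, by simp, by rwa [e1]⟩
  simpa [one_add_one_eq_two] using h

theorem contDiff_radial {G G1 G2 : ℝ → ℝ} (h1 : ∀ y, HasDerivAt G (G1 y) y)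
    (h2 : ∀ y, HasDerivAt G1 (G2 y) y) (hc : Continuous G2) (p : HypSpace n) :
    ContDiff ℝ 2 fun x => G (coshDist p x - 1) :=
  (contDiff_two_of_hasDerivAt h1 h2 hc).comp ((contDiff_coshDist p).sub contDiff_const)

/-- The Laplacian of a radial function. -/
theorem laplacian_radial {k : ℝ} (hk : 0 < k) {G G1 G2 : ℝ → ℝ}
    (h1 : ∀ y, HasDerivAt G (G1 y) y) (h2 : ∀ y, HasDerivAt G1 (G2 y) y) (hc : Continuous G2)
    (p x : HypSpace n) :
    laplacian k (fun x => G (coshDist p x - 1)) x =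
      k * ((coshDist p x - 1) * (coshDist p x - 1 + 2) * G2 (coshDist p x - 1) +
        n * (1 + (coshDist p x - 1)) * G1 (coshDist p x - 1)) := by
  have hC := (contDiff_radial h1 h2 hc p).contDiffAt (x := x)
  set s := √(1 + ‖x‖ ^ 2) with hs
  set r := √(1 + ‖p‖ ^ 2) with hr
  set y := coshDist p x - 1 with hy
  have hs0 : 0 < s := by positivity
  have hs2 : s ^ 2 = 1 + ‖x‖ ^ 2 := Real.sq_sqrt (by positivity)
  have hr2 : r ^ 2 = 1 + ‖p‖ ^ 2 := Real.sq_sqrt (by positivity)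
  have key : ∀ ξ : HypSpace n,
      fderiv ℝ (fun x => G (coshDist p x - 1)) x ξ = G1 y * (r * (⟪x, ξ⟫_ℝ / s) - ⟪p, ξ⟫_ℝ) ∧
      fderiv ℝ (fderiv ℝ fun x => G (coshDist p x - 1)) x ξ ξ =
        G2 y * (r * (⟪x, ξ⟫_ℝ / s) - ⟪p, ξ⟫_ℝ) ^ 2 +
        G1 y * (r * (‖ξ‖ ^ 2 / s - ⟪x, ξ⟫_ℝ ^ 2 / s ^ 3)) := by
    intro ξ
    have a1 : ∀ t : ℝ, HasDerivAt (fun t : ℝ => G (coshDist p (x + t • ξ) - 1)) _ t := fun t =>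
      HasDerivAt.comp t (h1 (coshDist p (x + t • ξ) - 1))
        ((hasDerivAt_coshDist_line p x ξ t).sub_const 1)
    have a2 := (HasDerivAt.comp (0 : ℝ) (h2 (coshDist p (x + (0 : ℝ) • ξ) - 1))
        ((hasDerivAt_coshDist_line p x ξ 0).sub_const 1)).mul
        (hasDerivAt_coshDist_line_deriv p x ξ)
    have := fderiv_eq_of_line hC a1 a2
    simp only [zero_smul, add_zero, zero_mul, Function.comp_apply] at this
    refine ⟨this.1, this.2.trans ?_⟩
    ring
  rw [laplacian_eq hk hC]
  simp only [key, norm_coordVec]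
  have e : ∀ i : Fin n, G2 y * (r * (⟪x, coordVec i⟫_ℝ / s) - ⟪p, coordVec i⟫_ℝ) ^ 2 +
        G1 y * (r * (1 ^ 2 / s - ⟪x, coordVec i⟫_ℝ ^ 2 / s ^ 3)) =
      G2 y * (r ^ 2 / s ^ 2) * (⟪x, coordVec i⟫_ℝ * ⟪x, coordVec i⟫_ℝ)
      - 2 * G2 y * (r / s) * (⟪x, coordVec i⟫_ℝ * ⟪p, coordVec i⟫_ℝ)
      + G2 y * (⟪p, coordVec i⟫_ℝ * ⟪p, coordVec i⟫_ℝ) + G1 y * r / s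
      - G1 y * r / s ^ 3 * (⟪x, coordVec i⟫_ℝ * ⟪x, coordVec i⟫_ℝ) := by
    intro i; ring
  simp only [e, Finset.sum_sub_distrib, Finset.sum_add_distrib, ← Finset.mul_sum,
    sum_inner_coordVec, Finset.sum_const, Finset.card_univ, Fintype.card_fin, nsmul_eq_mul,
    real_inner_self_eq_norm_sq]
  have e1 : ‖x‖ ^ 2 = s ^ 2 - 1 := by linarith
  have e2 : ‖p‖ ^ 2 = r ^ 2 - 1 := by linarith
  have e3 : y = r * s - ⟪p, x⟫_ℝ - 1 := by rw [hy, coshDist]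
  rw [e1, e2, real_inner_comm p x]
  generalize G2 y = g2
  generalize G1 y = g1
  rw [e3]
  field_simp
  ring

/-- The Laplacian of a function of the squared Euclidean distance to `p`. -/
theorem laplacian_euclidean {k : ℝ} (hk : 0 < k) {G G1 G2 : ℝ → ℝ}
    (h1 : ∀ y, HasDerivAt G (G1 y) y) (h2 : ∀ y, HasDerivAt G1 (G2 y) y) (hc : Continuous G2)
    (p x : HypSpace n) :
    ContDiff ℝ 2 (fun x => G (‖x - p‖ ^ 2)) ∧
    laplacian k (fun x => G (‖x - p‖ ^ 2)) x =
      k * (4 * (‖x - p‖ ^ 2 + ⟪x - p, x⟫_ℝ ^ 2) * G2 (‖x - p‖ ^ 2) +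
        2 * (n + ‖x‖ ^ 2 + n * ⟪x - p, x⟫_ℝ) * G1 (‖x - p‖ ^ 2)) := by
  have hC : ContDiff ℝ 2 (fun x : HypSpace n => G (‖x - p‖ ^ 2)) :=
    (contDiff_two_of_hasDerivAt h1 h2 hc).comp ((contDiff_id.sub contDiff_const).norm_sq ℝ)
  refine ⟨hC, ?_⟩
  set y := ‖x - p‖ ^ 2 with hy
  have key : ∀ ξ : HypSpace n,
      fderiv ℝ (fun x => G (‖x - p‖ ^ 2)) x ξ = G1 y * (2 * ⟪x - p, ξ⟫_ℝ) ∧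
      fderiv ℝ (fderiv ℝ fun x => G (‖x - p‖ ^ 2)) x ξ ξ =
        4 * G2 y * ⟪x - p, ξ⟫_ℝ ^ 2 + 2 * G1 y * ‖ξ‖ ^ 2 := by
    intro ξ
    have b1 : ∀ t : ℝ, HasDerivAt (fun t : ℝ => ‖x + t • ξ - p‖ ^ 2)
        (2 * (⟪x - p, ξ⟫_ℝ + t * ‖ξ‖ ^ 2)) t := by
      intro t
      have := ((hasDerivAt_line x ξ t).sub_const p).norm_sq
      rwa [add_sub_right_comm, inner_add_left, real_inner_smul_left,
        real_inner_self_eq_norm_sq] at this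
    have b2 : HasDerivAt (fun t : ℝ => 2 * (⟪x - p, ξ⟫_ℝ + t * ‖ξ‖ ^ 2)) (2 * ‖ξ‖ ^ 2) 0 := by
      simpa using (((hasDerivAt_id (0:ℝ)).mul_const (‖ξ‖ ^ 2)).const_add ⟪x - p, ξ⟫_ℝ).const_mul 2
    have a1 : ∀ t : ℝ, HasDerivAt (fun t : ℝ => G (‖x + t • ξ - p‖ ^ 2)) _ t := fun t =>
      HasDerivAt.comp t (h1 (‖x + t • ξ - p‖ ^ 2)) (b1 t)
    have a2 := (HasDerivAt.comp (0 : ℝ) (h2 (‖x + (0:ℝ) • ξ - p‖ ^ 2)) (b1 0)).mul b2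
    have := fderiv_eq_of_line hC.contDiffAt a1 a2
    simp only [zero_smul, add_zero, zero_mul, Function.comp_apply] at this
    refine ⟨this.1, this.2.trans ?_⟩
    ring
  rw [laplacian_eq hk hC.contDiffAt]
  simp only [key, norm_coordVec, pow_two ⟪x - p, coordVec _⟫_ℝ]
  simp only [Finset.sum_add_distrib, ← Finset.mul_sum,
    sum_inner_coordVec, Finset.sum_const, Finset.card_univ, Fintype.card_fin, nsmul_eq_mul,
    real_inner_self_eq_norm_sq]
  ring

end HypSpace

/-! ### Geodesic balls as sublevel sets of `coshDist`. -/

namespace HypSpace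

open Filter Set

variable {n : ℕ}

theorem coshDist_self (p : HypSpace n) : coshDist p p = 1 := by
  rw [coshDist, Real.mul_self_sqrt (by positivity), real_inner_self_eq_norm_sq]; ring

theorem one_le_coshDist (p x : HypSpace n) : 1 ≤ coshDist p x := by
  have h1 := real_inner_le_norm p x
  have h2 : 1 + ‖p‖ * ‖x‖ ≤ √(1 + ‖p‖ ^ 2) * √(1 + ‖x‖ ^ 2) := by
    rw [← Real.sqrt_mul (by positivity)]
    apply Real.le_sqrt_of_sq_le
    nlinarith [sq_nonneg (‖p‖ - ‖x‖)]
  rw [coshDist]; linarith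

/-- The function √(1 + ‖x‖²) is convex, and after squaring this is exactly `one_le_coshDist a b`.
Hence geodesic balls are convex in the coordinate, which yields their connectedness and the density
of the open ball in the closed one. -/
theorem coshDist_line_le (p a b : HypSpace n) {s t : ℝ} (hs : 0 ≤ s) (ht : 0 ≤ t)
    (hst : s + t = 1) : coshDist p (s • a + t • b) ≤ s * coshDist p a + t * coshDist p b := by
  have h1 : √(1 + ‖s • a + t • b‖ ^ 2) ≤ s * √(1 + ‖a‖ ^ 2) + t * √(1 + ‖b‖ ^ 2) := by
    apply Real.sqrt_le_iff.2 ⟨by positivity, ?_⟩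
    have h2 := one_le_coshDist a b
    rw [coshDist] at h2
    have h3 := Real.sq_sqrt (show 0 ≤ 1 + ‖a‖ ^ 2 by positivity)
    have h4 := Real.sq_sqrt (show 0 ≤ 1 + ‖b‖ ^ 2 by positivity)
    rw [norm_add_sq_real, norm_smul, norm_smul, real_inner_smul_left, real_inner_smul_right,
      mul_pow, mul_pow, Real.norm_of_nonneg hs, Real.norm_of_nonneg ht, add_sq, mul_pow, mul_pow,
      h3, h4]
    have h5 : 0 ≤ s * t := by positivity
    have h6 : 1 = s ^ 2 + 2 * (s * t) + t ^ 2 := by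
      have : (s + t) ^ 2 = 1 := by rw [hst]; norm_num
      nlinarith
    nlinarith [mul_le_mul_of_nonneg_left h2 h5]
  simp only [coshDist, inner_add_right, real_inner_smul_right]
  have h7 : 0 ≤ √(1 + ‖p‖ ^ 2) := by positivity
  nlinarith [mul_le_mul_of_nonneg_left h1 h7]

theorem convex_coshDist_lt (p : HypSpace n) (C : ℝ) : Convex ℝ {x | coshDist p x < C} := by
  intro a ha b hb s t hs ht hst
  have h := coshDist_line_le p a b hs ht hst
  have ha' : coshDist p a < C := ha
  have hb' : coshDist p b < C := hb
  show _ < C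
  rcases hs.eq_or_lt with rfl | hs'
  · have : t = 1 := by linarith
    subst this; linarith
  · have h1 := mul_pos hs' (sub_pos.2 ha')
    have h2 := mul_nonneg ht (sub_nonneg.2 hb'.le)
    have h3 : s * C + t * C = C := by rw [← add_mul, hst, one_mul]
    linarith

theorem isCompact_coshDist_le (p : HypSpace n) (C : ℝ) : IsCompact {x | coshDist p x ≤ C} := by
  apply Metric.isCompact_of_isClosed_isBounded
  · exact isClosed_le (continuous_coshDist p) continuous_const
  · have hp : 0 < √(1 + ‖p‖ ^ 2) - ‖p‖ := by
      have : ‖p‖ < √(1 + ‖p‖ ^ 2) := Real.lt_sqrt_of_sq_lt (by linarith)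
      linarith
    refine (Metric.isBounded_closedBall (x := (0 : HypSpace n))
      (r := C / (√(1 + ‖p‖ ^ 2) - ‖p‖))).subset fun x hx => ?_
    rw [mem_closedBall_zero_iff, le_div_iff₀ hp]
    have h1 := real_inner_le_norm p x
    have h2 : ‖x‖ ≤ √(1 + ‖x‖ ^ 2) := Real.le_sqrt_of_sq_le (by linarith)
    have h3 : coshDist p x ≤ C := hx
    rw [coshDist] at h3
    nlinarith [mul_le_mul_of_nonneg_left h2 (Real.sqrt_nonneg (1 + ‖p‖ ^ 2))]

theorem coshDist_le_subset_closure (p : HypSpace n) {C : ℝ} (hC : 1 < C) :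
    {x | coshDist p x ≤ C} ⊆ closure {x | coshDist p x < C} := by
  intro x hx
  have hx' : coshDist p x ≤ C := hx
  have h1 : Tendsto (fun t : ℝ => x + t • (p - x)) (𝓝[>] 0) (𝓝 x) :=
    (tendsto_line x (p - x)).mono_left nhdsWithin_le_nhds
  refine mem_closure_of_tendsto h1 ?_
  filter_upwards [Ioo_mem_nhdsGT (show (0 : ℝ) < 1 by norm_num)] with t ht
  have e : x + t • (p - x) = (1 - t) • x + t • p := by module
  have := coshDist_line_le p x p (by linarith [ht.2] : 0 ≤ 1 - t) ht.1.le (by ring)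
  rw [coshDist_self] at this
  show coshDist p _ < C
  rw [e]
  nlinarith [ht.1, ht.2]

theorem hdist_eq (k : ℝ) (p x : HypSpace n) : hdist k p x = Real.arcosh (coshDist p x) / √k := rfl

theorem hdist_lt_iff {k : ℝ} (hk : 0 < k) (p x : HypSpace n) {R : ℝ} (hR : 0 ≤ R) :
    hdist k p x < R ↔ coshDist p x < Real.cosh (√k * R) := by
  have h1 := one_le_coshDist p x
  have h2 := Real.one_le_cosh (√k * R)
  have h3 := Real.arcosh_lt_arcosh (x := coshDist p x) (y := Real.cosh (√k * R)) (by linarith)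
    (by linarith)
  rw [Real.arcosh_cosh (by positivity)] at h3
  rw [hdist_eq, div_lt_iff₀ (Real.sqrt_pos.2 hk), mul_comm R, h3]

theorem hdist_le_iff {k : ℝ} (hk : 0 < k) (p x : HypSpace n) {R : ℝ} (hR : 0 ≤ R) :
    hdist k p x ≤ R ↔ coshDist p x ≤ Real.cosh (√k * R) := by
  have h1 := one_le_coshDist p x
  have h2 := Real.one_le_cosh (√k * R)
  have h3 := Real.arcosh_le_arcosh (x := coshDist p x) (y := Real.cosh (√k * R)) (by linarith)
    (by linarith)
  rw [Real.arcosh_cosh (by positivity)] at h3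
  rw [hdist_eq, div_le_iff₀ (Real.sqrt_pos.2 hk), mul_comm R, h3]

theorem geodesicBall_eq {k : ℝ} (hk : 0 < k) (p : HypSpace n) {R : ℝ} (hR : 0 ≤ R) :
    geodesicBall k p R = {x | coshDist p x < Real.cosh (√k * R)} :=
  ext fun x => hdist_lt_iff hk p x hR

theorem closedGeodesicBall_eq {k : ℝ} (hk : 0 < k) (p : HypSpace n) {R : ℝ} (hR : 0 ≤ R) :
    closedGeodesicBall k p R = {x | coshDist p x ≤ Real.cosh (√k * R)} :=
  ext fun x => hdist_le_iff hk p x hR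

/-! ### Comparison and the strong maximum principle. -/

/-- Comparison with a positive supersolution. -/
theorem nonpos_of_comparison {k : ℝ} (hk : 0 < k) {D : Set (HypSpace n)} (hD : IsOpen D)
    (hK : IsCompact (closure D)) {u v : HypSpace n → ℝ} (hu : ContinuousOn u (closure D))
    (hv : ContinuousOn v (closure D)) (hu2 : ContDiffOn ℝ 2 u D) (hv2 : ContDiffOn ℝ 2 v D)
    (hpos : ∀ x ∈ closure D, 0 < u x) (hbd : ∀ x ∈ frontier D, v x ≤ 0) (μ : ℝ)
    (h : ∀ x ∈ D, 0 < v x →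
      v x * (laplacian k u x + μ * u x) < u x * (laplacian k v x + μ * v x)) :
    ∀ x ∈ closure D, v x ≤ 0 := by
  by_contra! hc
  obtain ⟨x₁, hx₁, hvx₁⟩ := hc
  obtain ⟨x₀, hx₀, hmax⟩ := hK.exists_isMaxOn ⟨x₁, hx₁⟩
    (hv.div hu fun x hx => (hpos x hx).ne')
  set M := v x₀ / u x₀ with hM
  have hMpos : 0 < M := (div_pos hvx₁ (hpos x₁ hx₁)).trans_le (hmax hx₁)
  have hv0 : v x₀ = M * u x₀ := by rw [hM, div_mul_cancel₀ _ (hpos x₀ hx₀).ne']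
  have hvpos : 0 < v x₀ := by rw [hv0]; exact mul_pos hMpos (hpos x₀ hx₀)
  have hx₀D : x₀ ∈ D := by
    by_contra hn
    exact absurd (hbd x₀ ⟨hx₀, fun hi => hn (interior_subset hi)⟩) (not_le.2 hvpos)
  have hmem := hD.mem_nhds hx₀D
  have hux := hu2.contDiffAt hmem
  have hvx := hv2.contDiffAt hmem
  -- With M the maximum of v/u, the function v - Mu is nonpositive and vanishes at x₀. Since v = Mu
  -- there, the zeroth-order terms cancel in `h`, and the sign of μ plays no role.
  have hloc : IsLocalMax (fun y => 1 * v y + (-M) * u y) x₀ := by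
    filter_upwards [hmem] with y hy
    have h1 : v y / u y ≤ M := hmax (subset_closure hy)
    rw [div_le_iff₀ (hpos y (subset_closure hy))] at h1
    show 1 * v y + (-M) * u y ≤ 1 * v x₀ + (-M) * u x₀
    rw [hv0]; linarith
  have h1 := laplacian_nonpos_of_isLocalMax hk
    ((contDiffAt_const.mul hvx).add (contDiffAt_const.mul hux)) hloc
  rw [laplacian_lincomb hk hvx hux] at h1
  have h2 := h x₀ hx₀D hvpos
  have h3 := hpos x₀ hx₀
  rw [hv0] at h2
  nlinarith [mul_nonneg h3.le (sub_nonneg.2 h1)]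

/-- Hopf's lemma on a Euclidean ball of the chart: w dominates a small multiple of a strictly
subharmonic function on a thin shell inside the sphere, which forces linear growth away from the
sphere. -/
theorem hopf_barrier {k : ℝ} (hk : 0 < k) {z y : HypSpace n} {δ m : ℝ} {w : HypSpace n → ℝ}
    {D : Set (HypSpace n)} (hD : IsOpen D)
    (hw : ContDiffOn ℝ 2 w D) (hw0 : ∀ x ∈ D, 0 ≤ w x) (hlap : ∀ x ∈ D, laplacian k w x ≤ 0)
    (hball : Metric.closedBall z δ ⊆ D) (hm : 0 < m)
    (hsub : {x | ‖x - y‖ ^ 2 ≤ m} ⊆ Metric.closedBall z δ)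
    (hpos : ∀ x, ‖x - y‖ ^ 2 < m → 0 < w x) :
    ∃ ε > 0, ∃ s₀ < m, ∀ x, s₀ ≤ ‖x - y‖ ^ 2 → ‖x - y‖ ^ 2 ≤ m → ε * (m - ‖x - y‖ ^ 2) ≤ w x := by
  have hcontE : Continuous fun x : HypSpace n => 2 * (n + ‖x‖ ^ 2 + n * ⟪x - y, x⟫_ℝ) := by
    fun_prop
  obtain ⟨M₀, hM₀⟩ := (isCompact_closedBall z δ).exists_bound_of_continuousOn hcontE.continuousOn
  set M := max M₀ 1 with hMdef
  have hM1 : 1 ≤ M := le_max_right _ _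
  have hMb : ∀ x ∈ Metric.closedBall z δ, 2 * (n + ‖x‖ ^ 2 + n * ⟪x - y, x⟫_ℝ) ≤ M := fun x hx =>
    (le_abs_self _).trans ((hM₀ x hx).trans (le_max_left _ _))
  -- M bounds the first-order coefficient. On the shell A(m - s) < 1/2, so the second-order term 8As
  -- exceeds 8M - 4 ≥ 4M, while the first-order term is at most 2M.
  set A := M / m with hA
  have hApos : 0 < A := by positivity
  have hAm : A * m = M := by rw [hA]; field_simp
  set s₀ := m - 1 / (2 * A) with hs₀
  have hinv : A * (1 / (2 * A)) = 1 / 2 := by field_simp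
  have hs₀m : s₀ < m := by
    have : 0 < 1 / (2 * A) := by positivity
    linarith
  set G : ℝ → ℝ := fun s => (m - s) + A * (m - s) ^ 2 with hG
  set G1 : ℝ → ℝ := fun s => -1 - 2 * A * (m - s) with hG1
  set G2 : ℝ → ℝ := fun _ => 2 * A with hG2
  have hd0 : ∀ s : ℝ, HasDerivAt (fun s : ℝ => m - s) (-1) s := fun s => by
    simpa using (hasDerivAt_id s).const_sub m
  have hd1 : ∀ s, HasDerivAt G (G1 s) s := fun s => by
    refine ((hd0 s).add (((hd0 s).pow 2).const_mul A)).congr_deriv ?_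
    simp [hG1]; ring
  have hd2 : ∀ s, HasDerivAt G1 (G2 s) s := fun s => by
    refine (((hd0 s).const_mul (2 * A)).const_sub (-1)).congr_deriv ?_
    simp [hG2]
  have hLap : ∀ x, s₀ < ‖x - y‖ ^ 2 → ‖x - y‖ ^ 2 < m →
      0 < laplacian k (fun x => G (‖x - y‖ ^ 2)) x := by
    intro x h1 h2
    rw [(laplacian_euclidean hk hd1 hd2 continuous_const y x).2]
    refine mul_pos hk ?_
    have hE := hMb x (hsub h2.le)
    set E := 2 * (n + ‖x‖ ^ 2 + n * ⟪x - y, x⟫_ℝ)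
    set s := ‖x - y‖ ^ 2
    have hq : 0 ≤ 8 * A * ⟪x - y, x⟫_ℝ ^ 2 := by positivity
    have h3 : A * (m - s) < 1 / 2 := by
      rw [← hinv]; exact mul_lt_mul_of_pos_left (by linarith) hApos
    have h4 : 0 ≤ A * (m - s) := mul_nonneg hApos.le (by linarith)
    have h5 : E * (1 + 2 * (A * (m - s))) ≤ M * (1 + 2 * (A * (m - s))) :=
      mul_le_mul_of_nonneg_right hE (by linarith)
    simp only [hG1, hG2]
    nlinarith
  set S := {x : HypSpace n | ‖x - y‖ ^ 2 = s₀} with hS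
  have hcs : Continuous fun x : HypSpace n => ‖x - y‖ ^ 2 := by fun_prop
  have hSc : IsCompact S := (isCompact_closedBall z δ).of_isClosed_subset
    (isClosed_eq hcs continuous_const) fun x (hx : _ = s₀) => hsub (show _ ≤ m by linarith)
  obtain ⟨w₀, hw₀, hwS⟩ : ∃ a, 0 < a ∧ ∀ x ∈ S, a ≤ w x := by
    refine hSc.exists_forall_le' (hw.continuousOn.mono fun x (hx : _ = s₀) =>
      hball (hsub (show _ ≤ m by linarith))) fun x (hx : _ = s₀) => hpos x (by linarith)
  have hg0 : 0 < G s₀ := by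
    have : 0 < m - s₀ := by linarith
    simp only [hG]; positivity
  refine ⟨w₀ / G s₀, by positivity, s₀, hs₀m, ?_⟩
  set ε := w₀ / G s₀ with hε
  have hεpos : 0 < ε := by positivity
  suffices hmain : ∀ x, s₀ ≤ ‖x - y‖ ^ 2 → ‖x - y‖ ^ 2 ≤ m → ε * G (‖x - y‖ ^ 2) ≤ w x by
    intro x h1 h2
    refine le_trans ?_ (hmain x h1 h2)
    refine mul_le_mul_of_nonneg_left ?_ hεpos.le
    simp only [hG]
    have : 0 ≤ A * (m - ‖x - y‖ ^ 2) ^ 2 := by positivity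
    linarith
  set C := {x : HypSpace n | s₀ ≤ ‖x - y‖ ^ 2 ∧ ‖x - y‖ ^ 2 ≤ m} with hC
  have hCD : C ⊆ D := fun x hx => hball (hsub hx.2)
  have hCc : IsCompact C := (isCompact_closedBall z δ).of_isClosed_subset
    ((isClosed_le continuous_const hcs).inter (isClosed_le hcs continuous_const))
    fun x hx => hsub hx.2
  have hGd : ContDiff ℝ 2 (fun x : HypSpace n => G (‖x - y‖ ^ 2)) :=
    (laplacian_euclidean hk hd1 hd2 continuous_const y y).1
  by_contra! hcon
  obtain ⟨x₁, h1, h2, h3⟩ := hcon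
  obtain ⟨x₀, hx₀, hmax⟩ := hCc.exists_isMaxOn (f := fun x => ε * G (‖x - y‖ ^ 2) + (-1) * w x)
    ⟨x₁, h1, h2⟩ ((continuousOn_const.mul hGd.continuous.continuousOn).add
      (continuousOn_const.mul (hw.continuousOn.mono hCD)))
  have hval : 0 < ε * G (‖x₀ - y‖ ^ 2) + (-1) * w x₀ := by
    have h4 : ε * G (‖x₁ - y‖ ^ 2) + (-1) * w x₁ ≤ ε * G (‖x₀ - y‖ ^ 2) + (-1) * w x₀ :=
      hmax ⟨h1, h2⟩
    linarith
  have hin : s₀ < ‖x₀ - y‖ ^ 2 := by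
    refine hx₀.1.lt_of_ne fun he => ?_
    have h4 := hwS x₀ he.symm
    rw [← he, hε, div_mul_cancel₀ _ hg0.ne'] at hval
    linarith
  have hout : ‖x₀ - y‖ ^ 2 < m := by
    refine hx₀.2.lt_of_ne fun he => ?_
    have h4 := hw0 x₀ (hCD hx₀)
    rw [he] at hval
    simp only [hG, sub_self] at hval
    linarith
  have hnhds : {x : HypSpace n | s₀ < ‖x - y‖ ^ 2 ∧ ‖x - y‖ ^ 2 < m} ∈ 𝓝 x₀ :=
    ((isOpen_lt continuous_const hcs).inter (isOpen_lt hcs continuous_const)).mem_nhds ⟨hin, hout⟩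
  have hloc : IsLocalMax (fun x => ε * G (‖x - y‖ ^ 2) + (-1) * w x) x₀ := by
    filter_upwards [hnhds] with x hx using hmax ⟨hx.1.le, hx.2.le⟩
  have hwx := hw.contDiffAt (hD.mem_nhds (hCD hx₀))
  have h5 := laplacian_nonpos_of_isLocalMax hk
    ((contDiffAt_const.mul hGd.contDiffAt).add (contDiffAt_const.mul hwx)) hloc
  rw [laplacian_lincomb hk hGd.contDiffAt hwx] at h5
  have h6 := hlap x₀ (hCD hx₀)
  have h7 := mul_pos hεpos (hLap x₀ hin hout)
  linarith

/-- If w(y) ≠ 0 for some y near z, let z' be a zero nearest to y. The ball about y through z'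
contains no zero inside, so Hopf's lemma gives growth of first order at z', although the gradient
vanishes at this interior minimum. -/
theorem eventually_eq_zero_of_superharmonic {k : ℝ} (hk : 0 < k) {D : Set (HypSpace n)}
    (hD : IsOpen D) {w : HypSpace n → ℝ} (hw : ContDiffOn ℝ 2 w D) (hw0 : ∀ x ∈ D, 0 ≤ w x)
    (hlap : ∀ x ∈ D, laplacian k w x ≤ 0) {z : HypSpace n} (hz : z ∈ D) (hwz : w z = 0) :
    ∀ᶠ y in 𝓝 z, w y = 0 := by
  obtain ⟨δ, hδ, hball⟩ := Metric.nhds_basis_closedBall.mem_iff.1 (hD.mem_nhds hz)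
  filter_upwards [Metric.ball_mem_nhds z (half_pos hδ)] with y hy
  by_contra hwy
  have hcs : Continuous fun x : HypSpace n => ‖x - y‖ ^ 2 := by fun_prop
  have hKc : IsCompact (Metric.closedBall z δ ∩ w ⁻¹' {0}) :=
    (isCompact_closedBall z δ).of_isClosed_subset
      ((hw.continuousOn.mono hball).preimage_isClosed_of_isClosed Metric.isClosed_closedBall
        isClosed_singleton) inter_subset_left
  obtain ⟨z', hz', hmin⟩ := hKc.exists_isMinOn ⟨z, Metric.mem_closedBall_self hδ.le, hwz⟩
    hcs.continuousOn
  set m := ‖z' - y‖ ^ 2 with hm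
  have hzy : dist z y < δ / 2 := by rw [dist_comm]; exact hy
  have hmz : m ≤ ‖z - y‖ ^ 2 := hmin ⟨Metric.mem_closedBall_self hδ.le, hwz⟩
  have hz'y : z' ≠ y := fun h => hwy (h ▸ hz'.2)
  have hmpos : 0 < m := by
    have : 0 < ‖z' - y‖ := norm_pos_iff.2 (sub_ne_zero.2 hz'y)
    positivity
  have hsub' : ∀ x, ‖x - y‖ ^ 2 ≤ m → dist x z < δ := by
    intro x hx
    have h1 : ‖x - y‖ ≤ ‖z - y‖ := by
      exact (sq_le_sq₀ (norm_nonneg _) (norm_nonneg _)).1 (hx.trans hmz)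
    rw [← dist_eq_norm, ← dist_eq_norm] at h1
    have := dist_triangle_right x z y
    linarith
  have hsub : {x | ‖x - y‖ ^ 2 ≤ m} ⊆ Metric.closedBall z δ := fun x hx => (hsub' x hx).le
  have hpos : ∀ x, ‖x - y‖ ^ 2 < m → 0 < w x := by
    intro x hx
    have hxb := hsub (show x ∈ {x | ‖x - y‖ ^ 2 ≤ m} from hx.le)
    refine (hw0 x (hball hxb)).lt_of_ne fun he => ?_
    have : m ≤ ‖x - y‖ ^ 2 := hmin ⟨hxb, he.symm⟩
    linarith
  obtain ⟨ε, hε, s₀, hs₀, hbar⟩ := hopf_barrier hk hD hw hw0 hlap hball hmpos hsub hpos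
  have hz'D : z' ∈ D := hball hz'.1
  have hwz' : w z' = 0 := hz'.2
  have hlocmin : IsLocalMin w z' := by
    filter_upwards [hD.mem_nhds hz'D] with x hx
    rw [hwz']; exact hw0 x hx
  have hd : HasDerivAt (fun t : ℝ => w (z' + t • (y - z'))) 0 0 := by
    have := (eventually_hasDerivAt_line (hw.contDiffAt (hD.mem_nhds hz'D)) (y - z')).self_of_nhds
    simpa [hlocmin.fderiv_eq_zero] using this
  have hdist : ∀ t : ℝ, ‖z' + t • (y - z') - y‖ ^ 2 = (1 - t) ^ 2 * m := by
    intro t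
    have : z' + t • (y - z') - y = (1 - t) • (z' - y) := by module
    rw [this, norm_smul, mul_pow, Real.norm_eq_abs, sq_abs]
  have hlim : Tendsto (fun t : ℝ => (1 - t) ^ 2 * m) (𝓝[>] 0) (𝓝 m) := by
    have : Continuous fun t : ℝ => (1 - t) ^ 2 * m := by fun_prop
    simpa using (this.tendsto 0).mono_left nhdsWithin_le_nhds
  -- The vanishing derivative gives w ≤ (εm/2)t along the segment, whereas the barrier gives w ≥ εm
  -- t(2 - t) with 0 < t < 1.
  have h1 := (hasDerivAt_iff_isLittleO_nhds_zero.1 hd).def (half_pos (mul_pos hε hmpos))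
  simp only [zero_add, zero_smul, add_zero, hwz', smul_zero, sub_zero] at h1
  obtain ⟨t, ht1, ht2, ht3⟩ := ((h1.filter_mono nhdsWithin_le_nhds).and
    ((hlim.eventually (lt_mem_nhds hs₀)).and
      (Ioo_mem_nhdsGT (show (0 : ℝ) < 1 by norm_num)))).exists
  have hle : (1 - t) ^ 2 * m ≤ m := by
    have : (1 - t) ^ 2 ≤ 1 := by nlinarith [ht3.1, ht3.2]
    nlinarith
  have h2 := hbar (z' + t • (y - z')) (by rw [hdist]; exact ht2.le) (by rw [hdist]; exact hle)
  rw [hdist] at h2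
  rw [Real.norm_of_nonneg ht3.1.le] at ht1
  have h3 := (le_abs_self _).trans ht1
  nlinarith [mul_pos hε hmpos, mul_pos (mul_pos hε hmpos) ht3.1, ht3.1, ht3.2,
    mul_pos (mul_pos (mul_pos hε hmpos) ht3.1) (sub_pos.2 ht3.2)]

/-- The strong maximum principle for superharmonic functions. -/
theorem eq_zero_of_superharmonic {k : ℝ} (hk : 0 < k) {D : Set (HypSpace n)}
    (hD : IsOpen D) (hDc : IsPreconnected D) {w : HypSpace n → ℝ} (hw : ContDiffOn ℝ 2 w D)
    (hw0 : ∀ x ∈ D, 0 ≤ w x) (hlap : ∀ x ∈ D, laplacian k w x ≤ 0) {z : HypSpace n} (hz : z ∈ D)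
    (hwz : w z = 0) : ∀ x ∈ D, w x = 0 := by
  have hU : IsOpen (D ∩ w ⁻¹' {0}) := by
    rw [isOpen_iff_mem_nhds]
    rintro x ⟨hx, hwx⟩
    filter_upwards [hD.mem_nhds hx, eventually_eq_zero_of_superharmonic hk hD hw hw0 hlap hx hwx]
      with y h1 h2 using ⟨h1, h2⟩
  have hV : IsOpen (D ∩ w ⁻¹' {0}ᶜ) :=
    hw.continuousOn.isOpen_inter_preimage hD isClosed_singleton.isOpen_compl
  have := IsPreconnected.subset_left_of_subset_union hU hV
    (by rw [Set.disjoint_left]; rintro x ⟨_, h1⟩ ⟨_, h2⟩; exact h2 h1)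
    (fun x hx => by simp [hx]) ⟨z, hz, hz, hwz⟩ hDc
  exact fun x hx => (this hx).2

end HypSpace

/-! ### The regular solution of the radial equation. -/

namespace RadialODE

open Filter Set

/-- For `y > 0` this is `(y (y + 2)) ^ (-ν - 1) ∫₀^y (s (s + 2)) ^ ν e(s) ds`; the substitution
`s = τ y` makes it regular at `y = 0`. -/
noncomputable def avg (ν : ℝ) (e : ℝ → ℝ) (y : ℝ) : ℝ :=
  ∫ τ in (0 : ℝ)..1, (2 + max y 0) ^ (-(ν + 1)) * (τ ^ ν * (2 + τ * max y 0) ^ ν) * e (τ * max y 0)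

theorem continuous_avg {ν : ℝ} (hν : 0 ≤ ν) {e : ℝ → ℝ} (he : Continuous e) :
    Continuous (avg ν e) := by
  apply intervalIntegral.continuous_parametric_intervalIntegral_of_continuous'
  simp only [Function.uncurry_def]
  have h1 : Continuous fun p : ℝ × ℝ => (2 + max p.1 0) ^ (-(ν + 1)) :=
    Continuous.rpow_const (by fun_prop) fun p => Or.inl (by positivity)
  have h2 : Continuous fun p : ℝ × ℝ => p.2 ^ ν := continuous_snd.rpow_const fun _ => Or.inr hν
  have h3 : Continuous fun p : ℝ × ℝ => (2 + p.2 * max p.1 0) ^ ν :=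
    Continuous.rpow_const (by fun_prop) fun _ => Or.inr hν
  fun_prop

/-- The kernel is at most (2 + z)⁻¹ ≤ 1, so `avg` does not increase sup bounds; this drives the
factorial decay of the iterates. -/
theorem abs_avg_integrand_le {ν : ℝ} (hν : 0 ≤ ν) {y τ b c : ℝ} (hτ0 : 0 ≤ τ)
    (hτ1 : τ ≤ 1) (hb : |b| ≤ c) :
    |(2 + max y 0) ^ (-(ν + 1)) * (τ ^ ν * (2 + τ * max y 0) ^ ν) * b| ≤ c := by
  set z := max y 0 with hz
  have hz0 : 0 ≤ z := le_max_right _ _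
  have h1 : τ ^ ν ≤ 1 := Real.rpow_le_one hτ0 hτ1 hν
  have h2 : (2 + τ * z) ^ ν ≤ (2 + z) ^ ν :=
    Real.rpow_le_rpow (by positivity) (by nlinarith) hν
  have h3 : (2 + z) ^ (-(ν + 1)) * (2 + z) ^ ν ≤ 1 := by
    rw [← Real.rpow_add (by positivity), show -(ν + 1) + ν = -1 by ring, Real.rpow_neg_one]
    exact inv_le_one_of_one_le₀ (by linarith)
  have h4 : 0 ≤ τ ^ ν := Real.rpow_nonneg hτ0 ν
  have h5 : 0 ≤ (2 + τ * z) ^ ν := by positivity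
  have h6 : 0 ≤ (2 + z) ^ (-(ν + 1)) := by positivity
  have h7 : (2 + z) ^ (-(ν + 1)) * (τ ^ ν * (2 + τ * z) ^ ν) ≤ 1 := by
    refine le_trans (mul_le_mul_of_nonneg_left ?_ h6) h3
    calc τ ^ ν * (2 + τ * z) ^ ν ≤ 1 * (2 + z) ^ ν := mul_le_mul h1 h2 h5 zero_le_one
      _ = _ := one_mul _
  rw [abs_mul, abs_of_nonneg (by positivity)]
  calc _ ≤ 1 * c := mul_le_mul h7 hb (abs_nonneg _) zero_le_one
    _ = c := one_mul c

theorem abs_avg_le {ν : ℝ} (hν : 0 ≤ ν) {e : ℝ → ℝ} {y c : ℝ}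
    (h : ∀ s, 0 ≤ s → s ≤ max y 0 → |e s| ≤ c) : |avg ν e y| ≤ c := by
  have hz0 : 0 ≤ max y 0 := le_max_right _ _
  have := intervalIntegral.norm_integral_le_of_norm_le_const (a := 0) (b := 1) (C := c)
    (f := fun τ => (2 + max y 0) ^ (-(ν + 1)) * (τ ^ ν * (2 + τ * max y 0) ^ ν) *
      e (τ * max y 0)) fun τ hτ => by
    rw [uIoc_of_le zero_le_one] at hτ
    exact abs_avg_integrand_le hν hτ.1.le hτ.2 (h _ (mul_nonneg hτ.1.le hz0)
      (mul_le_of_le_one_left hz0 hτ.2))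
  simpa [avg] using this

theorem avg_eq {ν : ℝ} (e : ℝ → ℝ) {y : ℝ} (hy : 0 < y) :
    avg ν e y = (y * (y + 2)) ^ (-(ν + 1)) * ∫ s in (0 : ℝ)..y, (s * (s + 2)) ^ ν * e s := by
  have h := intervalIntegral.mul_integral_comp_mul_right (a := 0) (b := 1)
    (f := fun s => (s * (s + 2)) ^ ν * e s) y
  rw [zero_mul, one_mul] at h
  rw [← h, avg, ← intervalIntegral.integral_const_mul, ← intervalIntegral.integral_const_mul]
  apply intervalIntegral.integral_congr
  intro τ hτ
  rw [uIcc_of_le zero_le_one] at hτ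
  simp only [max_eq_left hy.le]
  have h1 : 0 ≤ τ * y := mul_nonneg hτ.1 hy.le
  rw [Real.mul_rpow h1 (by positivity), Real.mul_rpow hτ.1 hy.le,
    Real.mul_rpow hy.le (by positivity), add_comm (τ * y), add_comm y]
  have h2 : y ^ (-(ν + 1)) * (y * y ^ ν) = 1 := by
    nth_rewrite 2 [← Real.rpow_one y]
    rw [← Real.rpow_add hy, ← Real.rpow_add hy, show -(ν + 1) + (1 + ν) = 0 by ring,
      Real.rpow_zero]
  linear_combination -((2 + y) ^ (-(ν + 1)) * τ ^ ν * (2 + τ * y) ^ ν * e (τ * y)) * h2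

theorem hasDerivAt_integral {f : ℝ → ℝ} (hf : Continuous f) (y : ℝ) :
    HasDerivAt (fun y => ∫ s in (0 : ℝ)..y, f s) (f y) y :=
  (hf.integral_hasStrictDerivAt 0 y).hasDerivAt

theorem hasDerivAt_avg {ν : ℝ} (hν : 0 ≤ ν) {e : ℝ → ℝ} (he : Continuous e) {y : ℝ}
    (hy : 0 < y) :
    HasDerivAt (avg ν e) ((e y - 2 * (ν + 1) * (1 + y) * avg ν e y) / (y * (y + 2))) y := by
  have hc : Continuous fun s : ℝ => (s * (s + 2)) ^ ν * e s :=
    (Continuous.rpow_const (by fun_prop) fun _ => Or.inr hν).mul he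
  have hW : 0 < y * (y + 2) := by positivity
  have h1 : HasDerivAt (fun s : ℝ => s * (s + 2)) (2 * (1 + y)) y := by
    refine ((hasDerivAt_id y).mul ((hasDerivAt_id y).add_const 2)).congr_deriv ?_
    simp; ring
  have h2 := (h1.rpow_const (p := -(ν + 1)) (Or.inl hW.ne')).mul (hasDerivAt_integral hc y)
  have h3 : avg ν e =ᶠ[𝓝 y] (fun y => (y * (y + 2)) ^ (-(ν + 1))) *
      fun y => ∫ s in (0 : ℝ)..y, (s * (s + 2)) ^ ν * e s := by
    filter_upwards [lt_mem_nhds hy] with z hz using avg_eq e hz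
  refine (h2.congr_of_eventuallyEq h3).congr_deriv ?_
  rw [avg_eq e hy]
  have h4 : (y * (y + 2)) ^ (-(ν + 1) - 1) = (y * (y + 2)) ^ (-(ν + 1)) / (y * (y + 2)) := by
    rw [Real.rpow_sub_one hW.ne']
  have h5 : (y * (y + 2)) ^ (-(ν + 1)) * (y * (y + 2)) ^ ν = 1 / (y * (y + 2)) := by
    rw [← Real.rpow_add hW, show -(ν + 1) + ν = -1 by ring, Real.rpow_neg_one, one_div]
  rw [h4, ← mul_assoc, h5]
  field_simp
  ring

/-- The iterates of the Volterra operator attached to the radial equation. -/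
noncomputable def iter (ν : ℝ) : ℕ → ℝ → ℝ
  | 0 => fun _ => 1
  | m + 1 => fun y => ∫ s in (0 : ℝ)..max y 0, avg ν (iter ν m) s

theorem continuous_iter {ν : ℝ} (hν : 0 ≤ ν) (m : ℕ) : Continuous (iter ν m) := by
  induction m with
  | zero => exact continuous_const
  | succ m ih =>
    have h : Continuous fun y => ∫ s in (0 : ℝ)..y, avg ν (iter ν m) s :=
      continuous_iff_continuousAt.2 fun y => (hasDerivAt_integral (continuous_avg hν ih) y).continuousAt
    exact h.comp (continuous_id.max continuous_const)

theorem abs_iter_le {ν : ℝ} (hν : 0 ≤ ν) (m : ℕ) (y : ℝ) :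
    |iter ν m y| ≤ (max y 0) ^ m / m.factorial := by
  induction m generalizing y with
  | zero => simp [iter]
  | succ m ih =>
    have hz0 : 0 ≤ max y 0 := le_max_right _ _
    have h1 : ∀ s ∈ Ioc 0 (max y 0), ‖avg ν (iter ν m) s‖ ≤ s ^ m / m.factorial := by
      intro s hs
      refine abs_avg_le hν fun r hr0 hr => (ih r).trans ?_
      rw [max_eq_left hr0]
      rw [max_eq_left hs.1.le] at hr
      gcongr
    have h2 := intervalIntegral.norm_integral_le_of_norm_le (μ := MeasureTheory.volume) hz0
      (Eventually.of_forall h1)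
      (Continuous.intervalIntegrable (by fun_prop) _ _)
    refine h2.trans (le_of_eq ?_)
    rw [intervalIntegral.integral_div, integral_pow, Nat.factorial_succ]
    push_cast
    field_simp
    simp

/-- The solution of the radial equation in dimension `2 (ν + 1)` as a Neumann series. -/
noncomputable def base (ν L y : ℝ) : ℝ := ∑' m, (-L) ^ m * iter ν m y

theorem abs_term_le {ν : ℝ} (hν : 0 ≤ ν) (m : ℕ) {L y B C : ℝ} (hL : |L| ≤ B) (hy : max y 0 ≤ C) :
    |(-L) ^ m * iter ν m y| ≤ (B * C) ^ m / m.factorial := by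
  have hz0 : 0 ≤ max y 0 := le_max_right _ _
  rw [abs_mul, abs_pow, abs_neg, mul_pow, mul_div_assoc]
  have h1 := abs_iter_le hν m y
  have h2 : (max y 0) ^ m / m.factorial ≤ C ^ m / m.factorial := by gcongr
  have h3 : |L| ^ m ≤ B ^ m := by gcongr
  exact mul_le_mul h3 (h1.trans h2) (abs_nonneg _) (pow_nonneg ((abs_nonneg L).trans hL) m)

theorem hasSum_base {ν : ℝ} (hν : 0 ≤ ν) (L y : ℝ) :
    HasSum (fun m => (-L) ^ m * iter ν m y) (base ν L y) :=
  (Summable.of_norm_bounded (Real.summable_pow_div_factorial (|L| * max y 0))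
    fun m => abs_term_le hν m le_rfl le_rfl).hasSum

/-- Joint continuity serves to vary the eigenvalue parameter in `exists_smaller_zero`. The factorial
bounds make the series converge uniformly on boxes. -/
theorem continuous_base {ν : ℝ} (hν : 0 ≤ ν) : Continuous fun p : ℝ × ℝ => base ν p.1 p.2 := by
  rw [continuous_iff_continuousAt]
  rintro ⟨L, y⟩
  set B := |L| + 1
  set C := max y 0 + 1
  have h1 : Continuous fun p : ℝ × ℝ => |p.1| := by fun_prop
  have h2 : Continuous fun p : ℝ × ℝ => max p.2 0 := by fun_prop
  have hopen : IsOpen {p : ℝ × ℝ | |p.1| < B ∧ max p.2 0 < C} :=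
    (isOpen_lt h1 continuous_const).inter (isOpen_lt h2 continuous_const)
  have h : ContinuousOn (fun p : ℝ × ℝ => ∑' m, (-p.1) ^ m * iter ν m p.2)
      {p : ℝ × ℝ | |p.1| < B ∧ max p.2 0 < C} := by
    refine continuousOn_tsum (fun m => Continuous.continuousOn ?_)
      (Real.summable_pow_div_factorial (B * C)) fun m p hp => abs_term_le hν m hp.1.le hp.2.le
    exact (continuous_fst.neg.pow m).mul ((continuous_iter hν m).comp continuous_snd)
  exact h.continuousAt (hopen.mem_nhds ⟨by simp [B], by simp [C]⟩)

theorem hasSum_integral {f : ℕ → ℝ → ℝ} {F : ℝ → ℝ} {c : ℕ → ℝ} {a b : ℝ} (hab : a ≤ b)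
    (hf : ∀ m, Continuous (f m)) (hc : Summable c) (hb : ∀ m, ∀ s, a ≤ s → s ≤ b → |f m s| ≤ c m)
    (hs : ∀ s, a ≤ s → s ≤ b → HasSum (fun m => f m s) (F s)) :
    HasSum (fun m => ∫ s in a..b, f m s) (∫ s in a..b, F s) := by
  refine intervalIntegral.hasSum_integral_of_dominated_convergence (fun m _ => c m)
    (fun m => (hf m).aestronglyMeasurable) (fun m => Eventually.of_forall fun s hs' => ?_)
    (Eventually.of_forall fun _ _ => hc) intervalIntegrable_const
    (Eventually.of_forall fun s hs' => ?_)
  · rw [uIoc_of_le hab] at hs'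
    exact hb m s hs'.1.le hs'.2
  · rw [uIoc_of_le hab] at hs'
    exact hs s hs'.1.le hs'.2

theorem hasSum_avg_base {ν : ℝ} (hν : 0 ≤ ν) (L y : ℝ) :
    HasSum (fun m => (-L) ^ m * avg ν (iter ν m) y) (avg ν (base ν L) y) := by
  have hz0 : 0 ≤ max y 0 := le_max_right _ _
  have h := hasSum_integral (a := 0) (b := 1) zero_le_one
    (f := fun m τ => (2 + max y 0) ^ (-(ν + 1)) * (τ ^ ν * (2 + τ * max y 0) ^ ν) *
      ((-L) ^ m * iter ν m (τ * max y 0)))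
    (F := fun τ => (2 + max y 0) ^ (-(ν + 1)) * (τ ^ ν * (2 + τ * max y 0) ^ ν) *
      base ν L (τ * max y 0)) (fun m => ?_)
    (Real.summable_pow_div_factorial (|L| * max y 0))
    (fun m τ h0 h1 => abs_avg_integrand_le hν h0 h1 (abs_term_le hν m le_rfl ?_))
    (fun τ h0 h1 => (hasSum_base hν L _).mul_left _)
  · have e : ∀ m, (-L) ^ m * avg ν (iter ν m) y = ∫ τ in (0 : ℝ)..1, (2 + max y 0) ^ (-(ν + 1)) *
        (τ ^ ν * (2 + τ * max y 0) ^ ν) * ((-L) ^ m * iter ν m (τ * max y 0)) := by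
      intro m
      rw [avg, ← intervalIntegral.integral_const_mul]
      congr 1
      funext τ
      ring
    simp only [e]
    exact h
  · have h2 : Continuous fun τ : ℝ => τ ^ ν := continuous_id.rpow_const fun _ => Or.inr hν
    have h3 : Continuous fun τ : ℝ => (2 + τ * max y 0) ^ ν :=
      Continuous.rpow_const (by fun_prop) fun _ => Or.inr hν
    have h4 := continuous_iter hν m
    fun_prop
  · rw [max_eq_left (mul_nonneg h0 hz0)]
    exact mul_le_of_le_one_left hz0 h1

/-- The Volterra form of the radial equation with F(0) = 1, obtained by integrating the Neumann
series term by term. -/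
theorem base_eq {ν : ℝ} (hν : 0 ≤ ν) (L y : ℝ) :
    base ν L y = 1 - L * ∫ s in (0 : ℝ)..max y 0, avg ν (base ν L) s := by
  have hz0 : 0 ≤ max y 0 := le_max_right _ _
  have h := (hasSum_integral (a := 0) (b := max y 0) hz0
    (f := fun m s => (-L) ^ m * avg ν (iter ν m) s) (F := avg ν (base ν L))
    (fun m => continuous_const.mul (continuous_avg hν (continuous_iter hν m)))
    (Real.summable_pow_div_factorial (|L| * max y 0)) (fun m s h0 h1 => ?_)
    (fun s h0 h1 => hasSum_avg_base hν L s)).mul_left (-L)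
  · have h2 : HasSum (fun m => (-L) ^ (m + 1) * iter ν (m + 1) y)
        (-L * ∫ s in (0 : ℝ)..max y 0, avg ν (base ν L) s) := by
      have e : ∀ m, (-L) ^ (m + 1) * iter ν (m + 1) y =
          -L * ∫ s in (0 : ℝ)..max y 0, (-L) ^ m * avg ν (iter ν m) s := by
        intro m
        rw [intervalIntegral.integral_const_mul, iter, pow_succ]
        ring
      simp only [e]
      exact h
    have h3 : base ν L y = ∑ m ∈ Finset.range 1, (-L) ^ m * iter ν m y +
        ∑' m, (-L) ^ (m + 1) * iter ν (m + 1) y :=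
      ((hasSum_base hν L y).summable.sum_add_tsum_nat_add 1).symm
    rw [h3, h2.tsum_eq, Finset.sum_range_one, pow_zero, one_mul, iter]
    ring
  · rw [abs_mul, abs_pow, abs_neg, mul_pow, mul_div_assoc]
    refine mul_le_mul_of_nonneg_left (abs_avg_le hν fun r hr0 hr => ?_) (by positivity)
    refine (abs_iter_le hν m r).trans ?_
    rw [max_eq_left hr0]
    rw [max_eq_left h0] at hr
    have := hr.trans h1
    gcongr

theorem continuous_base_right {ν : ℝ} (hν : 0 ≤ ν) (L : ℝ) : Continuous (base ν L) :=
  (continuous_base hν).comp (continuous_const.prodMk continuous_id)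

theorem base_zero {ν : ℝ} (hν : 0 ≤ ν) (L : ℝ) : base ν L 0 = 1 := by
  rw [base_eq hν]; simp

theorem hasDerivAt_base {ν : ℝ} (hν : 0 ≤ ν) (L : ℝ) {y : ℝ} (hy : 0 < y) :
    HasDerivAt (base ν L) (-L * avg ν (base ν L) y) y := by
  have h1 := ((hasDerivAt_integral (continuous_avg hν (continuous_base_right hν L)) y).const_mul
    L).const_sub 1
  have h2 : base ν L =ᶠ[𝓝 y] fun y => 1 - L * ∫ s in (0 : ℝ)..y, avg ν (base ν L) s := by
    filter_upwards [lt_mem_nhds hy] with z hz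
    rw [base_eq hν, max_eq_left (le_of_lt hz)]
  exact (h1.congr_of_eventuallyEq h2).congr_deriv (by ring)

/-- `K` is continuous with `K(0) = 1`, solves `y (y + 2) K'' + N (1 + y) K' + L K = 0` for `y > 0`,
and its derivative `K1` there extends continuously. -/
structure IsWeakSol (N L : ℝ) (K K1 : ℝ → ℝ) : Prop where
  cont : Continuous K
  zero : K 0 = 1
  deriv : ∀ y, 0 < y → HasDerivAt K (K1 y) y
  deriv2 : ∀ y, 0 < y → HasDerivAt K1 (-(N * (1 + y) * K1 y + L * K y) / (y * (y + 2))) y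
  cont_deriv : Continuous K1

theorem isWeakSol_base {ν : ℝ} (hν : 0 ≤ ν) (L : ℝ) :
    IsWeakSol (2 * (ν + 1)) L (base ν L) fun y => -L * avg ν (base ν L) y where
  cont := continuous_base_right hν L
  zero := base_zero hν L
  deriv y hy := hasDerivAt_base hν L hy
  deriv2 y hy := by
    refine ((hasDerivAt_avg hν (continuous_base_right hν L) hy).const_mul (-L)).congr_deriv ?_
    field_simp
    ring
  cont_deriv := continuous_const.mul (continuous_avg hν (continuous_base_right hν L))

/-- Lowering the dimension by two: if `K` solves the equation with parameters `N + 2`, `L + N`,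
then its primitive `H` solves the equation with parameters `N`, `L`, up to `y = 0`. -/
theorem IsWeakSol.primitive {N L : ℝ} (hN : 0 < N) {K K1 : ℝ → ℝ}
    (h : IsWeakSol (N + 2) (L + N) K K1) {y : ℝ} (hy : 0 ≤ y) :
    y * (y + 2) * (-(L / N) * K1 y) + N * (1 + y) * (-(L / N) * K y) +
      L * (1 - L / N * ∫ s in (0 : ℝ)..y, K s) = 0 := by
  -- D is the left side of the equation for H. Its derivative is -(L/N) times the left side of the
  -- equation for K, and D(0) = -L + L = 0 because K(0) = 1.
  set D : ℝ → ℝ := fun y => y * (y + 2) * (-(L / N) * K1 y) + N * (1 + y) * (-(L / N) * K y) +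
      L * (1 - L / N * ∫ s in (0 : ℝ)..y, K s) with hD
  have hint : ∀ y, HasDerivAt (fun y => ∫ s in (0 : ℝ)..y, K s) (K y) y :=
    hasDerivAt_integral h.cont
  have hcont : Continuous D := by
    have h1 := h.cont
    have h2 := h.cont_deriv
    have h3 : Continuous fun y => ∫ s in (0 : ℝ)..y, K s :=
      continuous_iff_continuousAt.2 fun y => (hint y).continuousAt
    fun_prop
  have hd : ∀ z, 0 < z → HasDerivAt D 0 z := by
    intro z hz
    have h1 : HasDerivAt (fun s : ℝ => s * (s + 2)) (2 * (1 + z)) z := by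
      refine ((hasDerivAt_id z).mul ((hasDerivAt_id z).add_const 2)).congr_deriv ?_
      simp; ring
    have h2 : HasDerivAt (fun s : ℝ => N * (1 + s)) N z := by
      simpa using ((hasDerivAt_id z).const_add 1).const_mul N
    have h3 := ((h1.mul ((h.deriv2 z hz).const_mul (-(L / N)))).add
      (h2.mul ((h.deriv z hz).const_mul (-(L / N))))).add
      ((((hint z).const_mul (L / N)).const_sub 1).const_mul L)
    refine h3.congr_deriv ?_
    field_simp
    ring
  have hD0 : D 0 = 0 := by
    simp only [hD, h.zero]
    field_simp
    simp
  rcases hy.eq_or_lt with rfl | hy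
  · exact hD0
  · obtain ⟨c, hc, hc'⟩ := exists_hasDerivAt_eq_slope D (fun _ => 0) hy hcont.continuousOn
      fun z hz => hd z hz.1
    rw [hD0, sub_zero, sub_zero, eq_comm, div_eq_zero_iff] at hc'
    exact hc'.resolve_right hy.ne'

theorem IsWeakSol.primitive_isWeakSol {N L : ℝ} (hN : 0 < N) {K K1 : ℝ → ℝ}
    (h : IsWeakSol (N + 2) (L + N) K K1) :
    IsWeakSol N L (fun y => 1 - L / N * ∫ s in (0 : ℝ)..y, K s) fun y => -(L / N) * K y where
  cont := continuous_iff_continuousAt.2 fun y =>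
    (((hasDerivAt_integral h.cont y).const_mul (L / N)).const_sub 1).continuousAt
  zero := by simp
  deriv y _ := (((hasDerivAt_integral h.cont y).const_mul (L / N)).const_sub 1).congr_deriv (by ring)
  deriv2 y hy := by
    refine ((h.deriv y hy).const_mul (-(L / N))).congr_deriv ?_
    have := h.primitive hN hy.le
    field_simp at this ⊢
    linarith
  cont_deriv := continuous_const.mul h.cont

/-- The derivative, up to a factor, of the radial eigenfunction. -/
noncomputable def preSol (n L y : ℝ) : ℝ :=
  1 - (L + n) / (n + 2) * ∫ s in (0 : ℝ)..y, base (n / 2 + 1) (L + n + (n + 2)) s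

/-- The radial eigenfunction in dimension `n`, in the variable `y = cosh r - 1`. -/
noncomputable def sol (n L y : ℝ) : ℝ := 1 - L / n * ∫ s in (0 : ℝ)..y, preSol n L s

noncomputable def sol1 (n L y : ℝ) : ℝ := -(L / n) * preSol n L y

noncomputable def sol2 (n L y : ℝ) : ℝ :=
  -(L / n) * (-((L + n) / (n + 2)) * base (n / 2 + 1) (L + n + (n + 2)) y)

/-- Differentiating the equation turns the parameters (N, L) into (N + 2, L + N). Starting at N = n
+ 4 and integrating twice makes `sol` of class C² on all of ℝ, across the singular point y = 0, with
`sol2` a multiple of the continuous function `base`. -/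
theorem isWeakSol_preSol {n : ℝ} (hn : 0 < n) (L : ℝ) : IsWeakSol (n + 2) (L + n) (preSol n L)
    fun y => -((L + n) / (n + 2)) * base (n / 2 + 1) (L + n + (n + 2)) y := by
  have h := isWeakSol_base (show 0 ≤ n / 2 + 1 by positivity) (L + n + (n + 2))
  rw [show 2 * (n / 2 + 1 + 1) = n + 2 + 2 by ring] at h
  exact h.primitive_isWeakSol (by positivity)

theorem continuous_preSol {n : ℝ} (hn : 0 < n) : Continuous fun p : ℝ × ℝ => preSol n p.1 p.2 := by
  have hν : 0 ≤ n / 2 + 1 := by positivity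
  have h : Continuous fun p : ℝ × ℝ => ∫ s in (0 : ℝ)..p.2,
      base (n / 2 + 1) (p.1 + n + (n + 2)) s := by
    refine intervalIntegral.continuous_parametric_intervalIntegral_of_continuous
      (f := fun (p : ℝ × ℝ) s => base (n / 2 + 1) (p.1 + n + (n + 2)) s) ?_ continuous_snd
    exact (continuous_base hν).comp (by fun_prop :
      Continuous fun q : (ℝ × ℝ) × ℝ => (q.1.1 + n + (n + 2), q.2))
  unfold preSol
  fun_prop

theorem continuous_sol {n : ℝ} (hn : 0 < n) : Continuous fun p : ℝ × ℝ => sol n p.1 p.2 := by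
  have h : Continuous fun p : ℝ × ℝ => ∫ s in (0 : ℝ)..p.2, preSol n p.1 s := by
    refine intervalIntegral.continuous_parametric_intervalIntegral_of_continuous
      (f := fun (p : ℝ × ℝ) s => preSol n p.1 s) ?_ continuous_snd
    exact (continuous_preSol hn).comp (by fun_prop : Continuous fun q : (ℝ × ℝ) × ℝ => (q.1.1, q.2))
  unfold sol
  fun_prop

theorem sol_at_zero (n L : ℝ) : sol n L 0 = 1 := by simp [sol]

theorem sol_zero_left (n y : ℝ) : sol n 0 y = 1 := by simp [sol]

theorem hasDerivAt_sol {n : ℝ} (hn : 0 < n) (L y : ℝ) : HasDerivAt (sol n L) (sol1 n L y) y :=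
  (((hasDerivAt_integral (isWeakSol_preSol hn L).cont y).const_mul (L / n)).const_sub 1).congr_deriv
    (by rw [sol1]; ring)

theorem hasDerivAt_sol1 {n : ℝ} (hn : 0 < n) (L y : ℝ) :
    HasDerivAt (sol1 n L) (sol2 n L y) y := by
  have h := (((hasDerivAt_integral (continuous_base_right (show 0 ≤ n / 2 + 1 by positivity)
    (L + n + (n + 2))) y).const_mul ((L + n) / (n + 2))).const_sub 1).const_mul (-(L / n))
  exact h.congr_deriv (by rw [sol2]; ring)

theorem continuous_sol2 {n : ℝ} (hn : 0 < n) (L : ℝ) : Continuous (sol2 n L) :=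
  continuous_const.mul (continuous_const.mul
    (continuous_base_right (show 0 ≤ n / 2 + 1 by positivity) _))

theorem sol_ode {n : ℝ} (hn : 0 < n) (L : ℝ) {y : ℝ} (hy : 0 ≤ y) :
    y * (y + 2) * sol2 n L y + n * (1 + y) * sol1 n L y + L * sol n L y = 0 :=
  (isWeakSol_preSol hn L).primitive hn hy

end RadialODE

/-! ### Zeros of the radial solution. -/

namespace RadialODE

open Filter Set

theorem continuous_sol_right {n : ℝ} (hn : 0 < n) (L : ℝ) : Continuous (sol n L) :=
  continuous_iff_continuousAt.2 fun y => (hasDerivAt_sol hn L y).continuousAt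

theorem continuous_sol1 {n : ℝ} (hn : 0 < n) (L : ℝ) : Continuous (sol1 n L) :=
  continuous_iff_continuousAt.2 fun y => (hasDerivAt_sol1 hn L y).continuousAt

/-- In divergence form the equation reads (W^(n/2) F')' = -L W^(n/2 - 1) F with W = y(y + 2), so the
flux starts at 0 and decreases while F > 0. -/
theorem sol1_neg {n L : ℝ} (hn : 0 < n) (hL : 0 < L) {Y : ℝ} (hY : 0 < Y)
    (hpos : ∀ y, 0 < y → y < Y → 0 < sol n L y) : sol1 n L Y < 0 := by
  set P : ℝ → ℝ := fun y => (y * (y + 2)) ^ (n / 2) * sol1 n L y with hP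
  have hcont : Continuous P :=
    (Continuous.rpow_const (by fun_prop) fun _ => Or.inr (by positivity)).mul
      (continuous_sol1 hn L)
  have hd : ∀ y, 0 < y → HasDerivAt P (-L * ((y * (y + 2)) ^ (n / 2 - 1) * sol n L y)) y := by
    intro y hy
    have hW : 0 < y * (y + 2) := by positivity
    have h1 : HasDerivAt (fun s : ℝ => s * (s + 2)) (2 * (1 + y)) y := by
      refine ((hasDerivAt_id y).mul ((hasDerivAt_id y).add_const 2)).congr_deriv ?_
      simp; ring
    refine ((h1.rpow_const (p := n / 2) (Or.inl hW.ne')).mul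
      (hasDerivAt_sol1 hn L y)).congr_deriv ?_
    have h2 := sol_ode hn L hy.le
    have h3 : (y * (y + 2)) ^ (n / 2) = (y * (y + 2)) ^ (n / 2 - 1) * (y * (y + 2)) := by
      rw [← Real.rpow_add_one hW.ne', sub_add_cancel]
    rw [h3]
    linear_combination (y * (y + 2)) ^ (n / 2 - 1) * h2
  have hanti : StrictAntiOn P (Icc 0 Y) := by
    refine strictAntiOn_of_deriv_neg (convex_Icc 0 Y) hcont.continuousOn fun y hy => ?_
    rw [interior_Icc] at hy
    rw [(hd y hy.1).deriv]
    have hW : 0 < y * (y + 2) := mul_pos hy.1 (by linarith [hy.1])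
    have := mul_pos (Real.rpow_pos_of_pos hW (n / 2 - 1)) (hpos y hy.1 hy.2)
    nlinarith
  have h := hanti (left_mem_Icc.2 hY.le) (right_mem_Icc.2 hY.le) hY
  have h0 : P 0 = 0 := by
    simp only [hP, zero_mul]
    rw [Real.zero_rpow (by positivity), zero_mul]
  rw [h0] at h
  have hW : 0 < Y * (Y + 2) := by positivity
  exact neg_of_mul_neg_right h (by positivity)

theorem exists_first_zero {n L : ℝ} (hn : 0 < n) {y : ℝ} (hy : 0 < y) (h : sol n L y ≤ 0) :
    ∃ Y, 0 < Y ∧ Y ≤ y ∧ sol n L Y = 0 ∧ ∀ s, 0 ≤ s → s < Y → 0 < sol n L s := by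
  have hc : IsCompact (Icc 0 y ∩ sol n L ⁻¹' Iic 0) :=
    isCompact_Icc.inter_right (isClosed_Iic.preimage (continuous_sol_right hn L))
  obtain ⟨Y, hY, hmin⟩ := hc.exists_isLeast ⟨y, ⟨hy.le, le_rfl⟩, h⟩
  have hpos : ∀ s, 0 ≤ s → s < Y → 0 < sol n L s := by
    intro s hs hsY
    by_contra! hn
    exact absurd (hmin ⟨⟨hs, hsY.le.trans hY.1.2⟩, hn⟩) (not_le.2 hsY)
  have hY0 : 0 < Y := by
    refine hY.1.1.lt_of_ne fun he => ?_
    have h2 : sol n L Y ≤ 0 := hY.2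
    rw [← he, sol_at_zero] at h2
    linarith
  refine ⟨Y, hY0, hY.1.2, le_antisymm hY.2 ?_, hpos⟩
  have ht : Tendsto (sol n L) (𝓝[<] Y) (𝓝 (sol n L Y)) :=
    ((continuous_sol_right hn L).tendsto Y).mono_left nhdsWithin_le_nhds
  refine ge_of_tendsto ht ?_
  filter_upwards [Ioo_mem_nhdsLT hY0] with s hs using (hpos s hs.1.le hs.2).le

/-- The first zero is a genuine crossing, since the derivative there is negative. -/
theorem sol_neg_right {n L : ℝ} (hn : 0 < n) (hL : 0 < L) {Y : ℝ} (hY : 0 < Y)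
    (h0 : sol n L Y = 0) (hpos : ∀ s, 0 ≤ s → s < Y → 0 < sol n L s) :
    ∀ᶠ y in 𝓝[>] Y, sol n L y < 0 := by
  have h1 := sol1_neg hn hL hY fun y hy => hpos y hy.le
  have h2 := (hasDerivAt_iff_tendsto_slope.1 (hasDerivAt_sol hn L Y)).eventually (gt_mem_nhds h1)
  have h3 : 𝓝[>] Y ≤ 𝓝[≠] Y := nhdsWithin_mono _ fun y hy => ne_of_gt hy
  filter_upwards [h3 h2, self_mem_nhdsWithin] with y hy hyY
  have hyY' : 0 < y - Y := sub_pos.2 hyY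
  have hy' : slope (sol n L) Y y < 0 := hy
  rw [slope_def_field, h0, sub_zero, div_neg_iff] at hy'
  rcases hy' with h | h
  · linarith [h.2]
  · exact h.1

/-- Above the bottom `(n - 1)² / 4` of the spectrum the radial eigenfunction changes sign. -/
theorem exists_nonpos {n L : ℝ} (hn : 0 < n) (hL0 : 0 < L) (hL : (n - 1) ^ 2 / 4 < L) :
    ∃ y, 0 < y ∧ sol n L y ≤ 0 := by
  by_contra! hpos
  have hneg : ∀ y, 0 < y → sol1 n L y < 0 := fun y hy =>
    sol1_neg hn hL0 hy fun s hs _ => hpos s hs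
  -- This δ gives (1 - 2δ)(L - 2δ) = (n - 1)²/4 + 4δ², so q² - (n - 1)q + L stays above 2δ(1 + q²).
  set δ := (L - (n - 1) ^ 2 / 4) / (2 * (1 + L)) with hδ
  have hδ0 : 0 < δ := div_pos (by linarith) (by positivity)
  have hδ1 : 2 * δ * (1 + L) = L - (n - 1) ^ 2 / 4 := by rw [hδ]; field_simp
  have hδ2 : 0 < 1 - 2 * δ := by nlinarith [sq_nonneg (n - 1)]
  have hquad : ∀ q : ℝ, 2 * δ * (1 + q ^ 2) ≤ q ^ 2 - (n - 1) * q + L := by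
    intro q
    have h1 : 0 ≤ (1 - 2 * δ) * ((1 - 2 * δ) * q ^ 2 - (n - 1) * q + (L - 2 * δ)) := by
      nlinarith [sq_nonneg ((1 - 2 * δ) * q - (n - 1) / 2), sq_nonneg δ]
    have := nonneg_of_mul_nonneg_right h1 hδ2
    linarith
  set Q : ℝ → ℝ := fun y => -(1 + y) * sol1 n L y / sol n L y with hQ
  -- Beyond y₁ the correction n/(y(y + 2)) is at most δ, which costs one of the two δ's in `hquad`.
  set y₁ := n / δ with hy₁
  have hy₁0 : 0 < y₁ := by positivity
  have hQpos : ∀ y, 0 < y → 0 < Q y := fun y hy =>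
    div_pos (by nlinarith [hneg y hy]) (hpos y hy)
  have hQd : ∀ y, 0 < y → HasDerivAt Q ((Q y ^ 2 - (n * (1 + 1 / (y * (y + 2))) - 1) * Q y +
      L * (1 + 1 / (y * (y + 2)))) / (1 + y)) y := by
    intro y hy
    have hS := (hpos y hy).ne'
    have h1 : HasDerivAt (fun y : ℝ => -(1 + y)) (-1) y := by
      exact ((hasDerivAt_id y).const_add 1).neg
    refine ((h1.mul (hasDerivAt_sol1 hn L y)).div (hasDerivAt_sol hn L y) hS).congr_deriv ?_
    have h2 := sol_ode hn L hy.le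
    have hW : y * (y + 2) ≠ 0 := by positivity
    have h3 : sol2 n L y = -(n * (1 + y) * sol1 n L y + L * sol n L y) / (y * (y + 2)) := by
      rw [eq_div_iff hW]; linarith
    rw [h3]
    simp only [hQ, Pi.mul_apply]
    have h4 : 1 + y ≠ 0 := by positivity
    have h5 : y + 2 ≠ 0 := by positivity
    field_simp
    ring
  have hQge : ∀ y, y₁ ≤ y → δ * (1 + Q y ^ 2) ≤ Q y ^ 2 - (n * (1 + 1 / (y * (y + 2))) - 1) * Q y +
      L * (1 + 1 / (y * (y + 2))) := by
    intro y hy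
    have hy0 : 0 < y := hy₁0.trans_le hy
    have hW : 0 < y * (y + 2) := by positivity
    have h1 := hquad (Q y)
    have h2 : n * (1 / (y * (y + 2))) ≤ δ := by
      rw [mul_one_div, div_le_iff₀ hW]
      have : n = δ * y₁ := by rw [hy₁]; field_simp
      rw [this]
      exact mul_le_mul_of_nonneg_left (by nlinarith) hδ0.le
    have h3 := hQpos y hy0
    have h4 : 0 ≤ L * (1 / (y * (y + 2))) := by positivity
    have h5 := mul_le_mul_of_nonneg_right h2 h3.le
    have h6 : δ * Q y ≤ δ * (1 + Q y ^ 2) :=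
      mul_le_mul_of_nonneg_left (by nlinarith [sq_nonneg (Q y - 1)]) hδ0.le
    nlinarith
  -- The Riccati inequality Q' ≥ δ(1 + Q²)/(1 + y) says that arctan Q grows at least like δ log(1 +
  -- y), which is impossible.
  set g : ℝ → ℝ := fun y => Real.arctan (Q y) - δ * Real.log (1 + y) with hg
  have hgd : ∀ y, 0 < y → HasDerivAt g (1 / (1 + Q y ^ 2) * ((Q y ^ 2 -
      (n * (1 + 1 / (y * (y + 2))) - 1) * Q y + L * (1 + 1 / (y * (y + 2)))) / (1 + y)) -
      δ * (1 / (1 + y))) y := by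
    intro y hy
    have h1 : HasDerivAt (fun y : ℝ => 1 + y) 1 y := (hasDerivAt_id y).const_add 1
    exact (hQd y hy).arctan.sub ((h1.log (by positivity)).const_mul δ)
  have hmono : MonotoneOn g (Ici y₁) := by
    refine monotoneOn_of_deriv_nonneg (convex_Ici y₁)
      (fun y hy => (hgd y (hy₁0.trans_le hy)).continuousAt.continuousWithinAt)
      (fun y hy => (hgd y (hy₁0.trans_le (interior_subset hy))).differentiableAt.differentiableWithinAt)
      fun y hy => ?_
    have hy' : y₁ ≤ y := interior_subset hy
    have hy0 := hy₁0.trans_le hy'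
    have h1 : 0 < 1 + Q y ^ 2 := by positivity
    have h2 : δ * (1 / (1 + y)) = 1 / (1 + Q y ^ 2) * (δ * (1 + Q y ^ 2) / (1 + y)) := by
      field_simp
    rw [(hgd y hy0).deriv, sub_nonneg, h2]
    exact mul_le_mul_of_nonneg_left
      (div_le_div_of_nonneg_right (hQge y hy') (by positivity)) (by positivity)
  have hlog : Tendsto (fun y : ℝ => δ * Real.log (1 + y)) atTop atTop :=
    (Real.tendsto_log_atTop.comp (tendsto_atTop_add_const_left _ 1 tendsto_id)).const_mul_atTop hδ0
  obtain ⟨y, h1, h2⟩ := ((hlog.eventually_gt_atTop (Real.pi / 2 - g y₁)).and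
    (eventually_ge_atTop y₁)).exists
  have h3 := hmono (mem_Ici.2 le_rfl) h2 h2
  have h4 := Real.arctan_lt_pi_div_two (Q y)
  simp only [hg] at h1 h3
  linarith

/-- Past the first zero for the parameter `L`, a smaller parameter has a zero. -/
theorem exists_smaller_zero {n L Y y : ℝ} (hn : 0 < n) (hL : 0 < L) (hY : 0 < Y)
    (h0 : sol n L Y = 0) (hpos : ∀ s, 0 ≤ s → s < Y → 0 < sol n L s) (hy : Y < y) :
    ∃ L' < L, sol n L' y = 0 := by
  -- The minimum over [0, y] goes continuously from 1 at parameter 0 to a negative value at L, so it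
  -- is 0 for some L' in between.
  set g : ℝ → ℝ := fun L => sInf (sol n L '' Icc 0 y) with hg
  have hgc : Continuous g := isCompact_Icc.continuous_sInf (continuous_sol hn)
  have hy0 : 0 < y := hY.trans hy
  have hne : (Icc 0 y).Nonempty := ⟨0, le_rfl, hy0.le⟩
  have hcomp : ∀ L, IsCompact (sol n L '' Icc 0 y) := fun L =>
    isCompact_Icc.image (continuous_sol_right hn L)
  have hg0 : g 0 = 1 := by
    have : sol n 0 = fun _ => 1 := funext fun y => sol_zero_left n y
    simp [hg, this, hne.image_const]
  have hgL : g L < 0 := by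
    obtain ⟨s, h1, h2⟩ := ((sol_neg_right hn hL hY h0 hpos).and (Ioo_mem_nhdsGT hy)).exists
    exact (csInf_le (hcomp L).bddBelow ⟨s, ⟨(hY.trans h2.1).le, h2.2.le⟩, rfl⟩).trans_lt h1
  obtain ⟨L', hL', hgL'⟩ : (0 : ℝ) ∈ g '' Icc 0 L :=
    intermediate_value_Icc' hL.le hgc.continuousOn ⟨hgL.le, by rw [hg0]; norm_num⟩
  have hL'0 : 0 < L' := hL'.1.lt_of_ne fun he => by
    rw [← he, hg0] at hgL'; norm_num at hgL'
  have hL'L : L' < L := hL'.2.lt_of_ne fun he => by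
    rw [he] at hgL'; linarith
  refine ⟨L', hL'L, ?_⟩
  have hnonneg : ∀ s ∈ Icc 0 y, 0 ≤ sol n L' s := fun s hs => by
    rw [← hgL']; exact csInf_le (hcomp L').bddBelow ⟨s, hs, rfl⟩
  obtain ⟨y₀, hy₀, hsol⟩ := (hcomp L').sInf_mem (hne.image _)
  have hsol' : sol n L' y₀ = 0 := hsol.trans hgL'
  have hy₀0 : 0 < y₀ := hy₀.1.lt_of_ne fun he => by
    rw [← he, sol_at_zero] at hsol'; norm_num at hsol'
  obtain ⟨Y', hY', hY'y, hz, hp⟩ := exists_first_zero hn hy₀0 hsol'.le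
  -- A first zero before y would be crossed, making the minimum negative; so it sits at y itself.
  rcases (hY'y.trans hy₀.2).eq_or_lt with rfl | hlt
  · exact hz
  · obtain ⟨s, h1, h2⟩ := ((sol_neg_right hn hL'0 hY' hz hp).and (Ioo_mem_nhdsGT hlt)).exists
    exact absurd (hnonneg s ⟨(hY'.trans h2.1).le, h2.2.le⟩) (not_le.2 h1)

end RadialODE

/-! ### Dirichlet eigenvalues of geodesic balls. -/

namespace HypSpace

open Filter Set

open RadialODE

variable {n : ℕ}

theorem laplacian_neg {k : ℝ} (hk : 0 < k) {u : HypSpace n → ℝ} {x : HypSpace n}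
    (hu : ContDiffAt ℝ 2 u x) : laplacian k (fun y => -u y) x = -laplacian k u x := by
  have h := laplacian_lincomb hk hu hu (-1) 0
  simpa using h

/-- The radial eigenfunction about `p` for the eigenvalue `k * L`. -/
noncomputable def radialSol (L : ℝ) (p x : HypSpace n) : ℝ := sol n L (coshDist p x - 1)

theorem contDiff_radialSol (hn : 0 < n) (L : ℝ) (p : HypSpace n) :
    ContDiff ℝ 2 (radialSol L p) :=
  have hn' : (0 : ℝ) < n := Nat.cast_pos.2 hn
  contDiff_radial (hasDerivAt_sol hn' L) (hasDerivAt_sol1 hn' L) (continuous_sol2 hn' L) p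

theorem laplacian_radialSol (hn : 0 < n) {k : ℝ} (hk : 0 < k) (L : ℝ) (p x : HypSpace n) :
    laplacian k (radialSol L p) x + k * L * radialSol L p x = 0 := by
  have hn' : (0 : ℝ) < n := Nat.cast_pos.2 hn
  have h1 := laplacian_radial hk (hasDerivAt_sol hn' L) (hasDerivAt_sol1 hn' L)
    (continuous_sol2 hn' L) p x
  have h2 := sol_ode hn' L (sub_nonneg.2 (one_le_coshDist p x))
  have h3 : laplacian k (radialSol L p) x = _ := h1
  rw [h3, radialSol]
  linear_combination k * h2

theorem radialSol_self (L : ℝ) (p : HypSpace n) : radialSol L p p = 1 := by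
  rw [radialSol, coshDist_self, sub_self, sol_at_zero]

theorem closure_subset (p : HypSpace n) (C : ℝ) :
    closure {x | coshDist p x < C} ⊆ {x | coshDist p x ≤ C} :=
  closure_lt_subset_le (continuous_coshDist p) continuous_const

theorem frontier_subset (p : HypSpace n) (C : ℝ) :
    frontier {x | coshDist p x < C} ⊆ {x | coshDist p x = C} :=
  frontier_lt_subset_eq (continuous_coshDist p) continuous_const

theorem isOpen_coshDist_lt (p : HypSpace n) (C : ℝ) : IsOpen {x | coshDist p x < C} :=
  isOpen_lt (continuous_coshDist p) continuous_const

/-- A positive radial strict supersolution excludes an eigenvalue. -/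
theorem not_isDirichletEigenvalue {k : ℝ} (hk : 0 < k) {G G1 G2 : ℝ → ℝ}
    (h1 : ∀ y, HasDerivAt G (G1 y) y) (h2 : ∀ y, HasDerivAt G1 (G2 y) y) (hc : Continuous G2)
    {Y M : ℝ} (hpos : ∀ y, 0 ≤ y → y ≤ Y → 0 < G y)
    (hsup : ∀ y, 0 ≤ y → y < Y → y * (y + 2) * G2 y + n * (1 + y) * G1 y + M * G y < 0)
    (p : HypSpace n) : ¬ IsDirichletEigenvalue k {x | coshDist p x < 1 + Y} (k * M) := by
  rintro ⟨w, hw2, hwc, ⟨x, hx, hwx⟩, hw, hbd⟩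
  set D := {x | coshDist p x < 1 + Y} with hD
  have hDo : IsOpen D := isOpen_coshDist_lt p _
  have hK : IsCompact (closure D) :=
    (isCompact_coshDist_le p (1 + Y)).of_isClosed_subset isClosed_closure (closure_subset p _)
  have hV := contDiff_radial h1 h2 hc p
  have hVpos : ∀ x ∈ closure D, 0 < G (coshDist p x - 1) := fun x hx => by
    have h3 : coshDist p x ≤ 1 + Y := closure_subset p _ hx
    exact hpos _ (sub_nonneg.2 (one_le_coshDist p x)) (by linarith)
  have hVlap : ∀ x ∈ D, laplacian k (fun x => G (coshDist p x - 1)) x +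
      k * M * G (coshDist p x - 1) < 0 := fun x hx => by
    have h3 : coshDist p x < 1 + Y := hx
    have h4 := hsup _ (sub_nonneg.2 (one_le_coshDist p x)) (by linarith)
    rw [laplacian_radial hk h1 h2 hc]
    have := mul_neg_of_pos_of_neg hk h4
    linarith
  have key : ∀ v : HypSpace n → ℝ, ContDiffOn ℝ 2 v D → ContinuousOn v (closure D) →
      (∀ x ∈ D, laplacian k v x + k * M * v x = 0) → (∀ x ∈ frontier D, v x = 0) →
      ∀ x ∈ D, v x ≤ 0 := by
    intro v hv2 hvc hv hvb x hx
    refine nonpos_of_comparison hk hDo hK hV.continuous.continuousOn hvc hV.contDiffOn hv2 hVpos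
      (fun x hx => (hvb x hx).le) (k * M) (fun x hx hvx => ?_) x (subset_closure hx)
    rw [hv x hx, mul_zero]
    exact mul_neg_of_pos_of_neg hvx (hVlap x hx)
  have ha := key w hw2 hwc hw hbd x hx
  -- Comparison applies to w and to -w, so the eigenfunction vanishes.
  have hb := key (fun x => -w x) hw2.neg hwc.neg (fun x hx => by
    rw [laplacian_neg hk (hw2.contDiffAt (hDo.mem_nhds hx))]
    linarith [hw x hx]) (fun x hx => by rw [hbd x hx, neg_zero]) x hx
  exact hwx (by linarith)

theorem isDirichletEigenvalue_of_zero (hn : 0 < n) {k : ℝ} (hk : 0 < k) {L Y : ℝ} (hY : 0 < Y)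
    (h0 : sol n L Y = 0) (p : HypSpace n) :
    IsDirichletEigenvalue k {x | coshDist p x < 1 + Y} (k * L) := by
  refine ⟨radialSol L p, (contDiff_radialSol hn L p).contDiffOn,
    (contDiff_radialSol hn L p).continuous.continuousOn, ⟨p, ?_, ?_⟩,
    fun x _ => laplacian_radialSol hn hk L p x, fun x hx => ?_⟩
  · show coshDist p p < 1 + Y
    rw [coshDist_self]; linarith
  · rw [radialSol_self]; norm_num
  · have h : coshDist p x = 1 + Y := frontier_subset p _ hx
    rw [radialSol, h, add_sub_cancel_left, h0]

/-- The solution vanishes at Y, so it is replaced by the dilation y ↦ F(sy) with s < 1, which is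
positive up to Y. For s close enough to 1 that M < sL, it remains a strict supersolution for M. -/
theorem not_isDirichletEigenvalue_of_lt (hn : 0 < n) {k : ℝ} (hk : 0 < k) {L M Y : ℝ} (hL : 0 < L)
    (hM : M < L) (hpos : ∀ s, 0 ≤ s → s < Y → 0 < sol n L s) (hY : 0 < Y) (p : HypSpace n) :
    ¬ IsDirichletEigenvalue k {x | coshDist p x < 1 + Y} (k * M) := by
  have hn' : (0 : ℝ) < n := Nat.cast_pos.2 hn
  obtain ⟨s, hs, hs1⟩ := exists_between (show max (M / L) 0 < 1 from
    max_lt ((div_lt_one hL).2 hM) one_pos)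
  have hs0 : 0 < s := (le_max_right _ _).trans_lt hs
  have hMs : M < s * L := (div_lt_iff₀ hL).1 ((le_max_left _ _).trans_lt hs)
  have hlin : ∀ y : ℝ, HasDerivAt (fun y => s * y) s y := fun y => by
    simpa using (hasDerivAt_id y).const_mul s
  refine not_isDirichletEigenvalue hk (G := fun y => sol n L (s * y))
    (G1 := fun y => sol1 n L (s * y) * s) (G2 := fun y => sol2 n L (s * y) * s * s)
    (fun y => (hasDerivAt_sol hn' L (s * y)).comp y (hlin y))
    (fun y => ((hasDerivAt_sol1 hn' L (s * y)).comp y (hlin y)).mul_const s)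
    (by have := continuous_sol2 hn' L; fun_prop)
    (fun y hy0 hy => hpos _ (by positivity) ?_) (fun y hy0 hy => ?_) p
  · rcases hy0.eq_or_lt with rfl | h
    · simpa using hY
    · exact (mul_lt_of_lt_one_left h hs1).trans_le hy
  · have hsy : s * y ≤ y := mul_le_of_le_one_left hy0 hs1.le
    have hF := hpos (s * y) (by positivity) (hsy.trans_lt hy)
    have hF1 : sol1 n L (s * y) ≤ 0 := by
      rcases hy0.eq_or_lt with rfl | h
      · have := sol_ode hn' L (y := 0) le_rfl
        rw [sol_at_zero] at this
        rw [mul_zero]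
        nlinarith
      · exact (sol1_neg hn' hL (mul_pos hs0 h) fun t ht ht' =>
          hpos t ht.le (ht'.trans (hsy.trans_lt hy))).le
    have hode := sol_ode hn' L (y := s * y) (by positivity)
    have hden : 0 < s * y + 2 := by positivity
    set F := sol n L (s * y)
    set F1 := sol1 n L (s * y)
    set F2 := sol2 n L (s * y)
    -- The factor sy + 2 allows F'' to be eliminated by the equation at sy; both remaining
    -- coefficients then have a favorable sign.
    have e : (s * y + 2) * (y * (y + 2) * (F2 * s * s) + n * (1 + y) * (F1 * s) + M * F) =
        n * s * (y * (1 - s)) * F1 + (M * (s * y + 2) - s * (y + 2) * L) * F := by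
      linear_combination s * (y + 2) * hode
    have h1 : n * s * (y * (1 - s)) * F1 ≤ 0 :=
      mul_nonpos_of_nonneg_of_nonpos
        (mul_nonneg (by positivity) (mul_nonneg hy0 (by linarith))) hF1
    have h2 : M * (s * y + 2) - s * (y + 2) * L < 0 := by
      have h3 : M * (s * y + 2) < s * L * (s * y + 2) := mul_lt_mul_of_pos_right hMs hden
      have h4 : s * L * (s * y + 2) ≤ s * L * (y + 2) :=
        mul_le_mul_of_nonneg_left (by linarith) (by positivity)
      linarith
    have h3 := mul_neg_of_neg_of_pos h2 hF
    exact neg_of_mul_neg_right (by rw [e]; linarith) hden.le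

/-- The radial operator maps 1 + y to (n + L)(1 + y) > 0, so subtracting ε(1 + y) makes the solution
a strict supersolution. It stays positive on [0, Y'] because the solution is bounded below there. -/
theorem not_isDirichletEigenvalue_of_small (hn : 0 < n) {k : ℝ} (hk : 0 < k) {L Y' Y : ℝ}
    (hL : 0 < L) (hpos : ∀ s, 0 ≤ s → s < Y → 0 < sol n L s) (hY' : 0 < Y') (hY : Y' < Y)
    (p : HypSpace n) : ¬ IsDirichletEigenvalue k {x | coshDist p x < 1 + Y'} (k * L) := by
  have hn' : (0 : ℝ) < n := Nat.cast_pos.2 hn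
  obtain ⟨a, ha, hle⟩ := isCompact_Icc.exists_forall_le' (s := Icc 0 Y')
    (continuous_sol_right hn' L).continuousOn (a := 0) fun s hs => hpos s hs.1 (hs.2.trans_lt hY)
  set ε := a / (2 * (1 + Y')) with hε
  have hε0 : 0 < ε := by positivity
  have hεa : ε * (1 + Y') = a / 2 := by rw [hε]; field_simp
  have hlin : ∀ y : ℝ, HasDerivAt (fun y => ε * (1 + y)) ε y := fun y => by
    simpa using ((hasDerivAt_id y).const_add 1).const_mul ε
  refine not_isDirichletEigenvalue hk (G := fun y => sol n L y - ε * (1 + y))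
    (G1 := fun y => sol1 n L y - ε) (G2 := fun y => sol2 n L y)
    (fun y => (hasDerivAt_sol hn' L y).sub (hlin y))
    (fun y => (hasDerivAt_sol1 hn' L y).sub_const ε) (continuous_sol2 hn' L)
    (fun y hy0 hy => ?_) (fun y hy0 hy => ?_) p
  · have h1 := hle y ⟨hy0, hy⟩
    have h2 : ε * (1 + y) ≤ ε * (1 + Y') := by gcongr
    linarith
  · have h1 := sol_ode hn' L hy0
    have h2 : 0 < ε * (n + L) * (1 + y) := by positivity
    nlinarith

/-- The ball on which the radial eigenfunction is positive is the only ball about its center with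
first eigenvalue `k * L`. -/
theorem isFirstDirichletEigenvalue_iff (hn : 0 < n) {k : ℝ} (hk : 0 < k) {L Y Y' : ℝ} (hL : 0 < L)
    (hY : 0 < Y) (h0 : sol n L Y = 0) (hpos : ∀ s, 0 ≤ s → s < Y → 0 < sol n L s) (hY' : 0 < Y')
    (p : HypSpace n) :
    IsFirstDirichletEigenvalue k {x | coshDist p x < 1 + Y'} (k * L) ↔ Y' = Y := by
  constructor
  · rintro ⟨hmem, hleast⟩
    rcases lt_trichotomy Y' Y with h | h | h
    · exact absurd hmem (not_isDirichletEigenvalue_of_small hn hk hL hpos hY' h p)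
    · exact h
    · obtain ⟨L', hL', hz⟩ := exists_smaller_zero (Nat.cast_pos.2 hn) hL hY h0 hpos h
      have := hleast (isDirichletEigenvalue_of_zero hn hk hY' hz p)
      nlinarith
  · rintro rfl
    refine ⟨isDirichletEigenvalue_of_zero hn hk hY h0 p, fun μ hμ => ?_⟩
    by_contra! hlt
    have e : k * (μ / k) = μ := mul_div_cancel₀ μ hk.ne'
    refine not_isDirichletEigenvalue_of_lt hn hk hL (M := μ / k) ?_ hpos hY p (e.symm ▸ hμ)
    rwa [div_lt_iff₀ hk, mul_comm]

/-! ### Positive supersolutions on balls and the rigidity statement. -/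

/-- A positive supersolution does not exist in a neighborhood of the closed ball. -/
theorem not_closedBall_subset (hn : 0 < n) {k : ℝ} (hk : 0 < k) {L Y : ℝ} (hL : 0 < L)
    (hY : 0 < Y) (h0 : sol n L Y = 0) (hpos : ∀ s, 0 ≤ s → s < Y → 0 < sol n L s)
    {Ω : Set (HypSpace n)} (hΩ : IsOpen Ω) {u : HypSpace n → ℝ} (hu : ContDiffOn ℝ 2 u Ω)
    (hupos : ∀ x ∈ Ω, 0 < u x) (hlap : ∀ x ∈ Ω, laplacian k u x + k * L * u x ≤ 0)
    (p : HypSpace n) : ¬ {x | coshDist p x ≤ 1 + Y} ⊆ Ω := by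
  intro hsub
  have hn' : (0 : ℝ) < n := Nat.cast_pos.2 hn
  -- By compactness the complement of Ω keeps a positive distance from the closed ball, so a
  -- slightly larger ball, of parameter Y', still lies in Ω.
  obtain ⟨a, ha, hK⟩ := ((isCompact_coshDist_le p (1 + Y + 1)).diff hΩ).exists_forall_le'
    (continuous_coshDist p).continuousOn (a := 1 + Y) fun x hx => by
      by_contra! h; exact hx.2 (hsub h)
  obtain ⟨Y', hneg, hY'⟩ := ((sol_neg_right hn' hL hY h0 hpos).and (Ioo_mem_nhdsGT
    (show Y < min (a - 1) (Y + 1) from lt_min (by linarith) (by linarith)))).exists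
  have hYY' := hY'.1
  have hY'a := hY'.2.trans_le (min_le_left _ _)
  have hY'1 := hY'.2.trans_le (min_le_right _ _)
  have hsub' : {x | coshDist p x ≤ 1 + Y'} ⊆ Ω := by
    intro x hx
    have hx' : coshDist p x ≤ 1 + Y' := hx
    by_contra hxΩ
    have := hK x ⟨show coshDist p x ≤ _ by linarith, hxΩ⟩
    linarith
  set D := {x | coshDist p x < 1 + Y'} with hD
  have hDo : IsOpen D := isOpen_coshDist_lt p _
  have hcl : closure D ⊆ Ω := (closure_subset p _).trans hsub'
  have hKc : IsCompact (closure D) :=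
    (isCompact_coshDist_le p (1 + Y')).of_isClosed_subset isClosed_closure (closure_subset p _)
  -- Adding ε(1 + y) makes the solution a strict subsolution. Its boundary value is half of the
  -- negative number F(Y'), but it equals 1 + ε > 0 at the center.
  set ε := -sol n L Y' / (2 * (1 + Y')) with hε
  have h1Y' : 0 < 1 + Y' := by linarith
  have hε0 : 0 < ε := div_pos (by linarith) (by linarith)
  have hεY : ε * (1 + Y') = -sol n L Y' / 2 := by rw [hε]; field_simp
  have hlin : ∀ y : ℝ, HasDerivAt (fun y => ε * (1 + y)) ε y := fun y => by
    simpa using ((hasDerivAt_id y).const_add 1).const_mul ε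
  have hd1 : ∀ y, HasDerivAt (fun y => sol n L y + ε * (1 + y)) (sol1 n L y + ε) y :=
    fun y => (hasDerivAt_sol hn' L y).add (hlin y)
  have hd2 : ∀ y, HasDerivAt (fun y => sol1 n L y + ε) (sol2 n L y) y :=
    fun y => (hasDerivAt_sol1 hn' L y).add_const ε
  have hv := contDiff_radial hd1 hd2 (continuous_sol2 hn' L) p
  have hp : p ∈ D := by
    show coshDist p p < 1 + Y'
    rw [coshDist_self]; linarith
  have := nonpos_of_comparison hk hDo hKc (hu.continuousOn.mono hcl) hv.continuous.continuousOn
    (hu.mono (subset_closure.trans hcl)) hv.contDiffOn (fun x hx => hupos x (hcl hx))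
    (fun x hx => by
      have h : coshDist p x = 1 + Y' := frontier_subset p _ hx
      simp only [h, add_sub_cancel_left, hεY]
      linarith) (k * L) (fun x hx hvx => by
      have hxΩ := hcl (subset_closure hx)
      have h1 := mul_nonpos_of_nonneg_of_nonpos hvx.le (hlap x hxΩ)
      refine h1.trans_lt (mul_pos (hupos x hxΩ) ?_)
      rw [laplacian_radial hk hd1 hd2 (continuous_sol2 hn' L)]
      have hy := sub_nonneg.2 (one_le_coshDist p x)
      have h2 := sol_ode hn' L hy
      set y := coshDist p x - 1
      have h3 : 0 < k * (ε * (n + L) * (1 + y)) := by positivity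
      linear_combination h3 - k * h2) p (subset_closure hp)
  simp only [coshDist_self, sub_self, sol_at_zero] at this
  linarith

/-- A subsolution that is nonpositive on the two boundary spheres of a thin annulus is nonpositive
in the annulus. -/
theorem nonpos_on_annulus {k : ℝ} (hk : 0 < k) {L y₀ Y A : ℝ} (hL : 0 < L) (hy₀ : 0 < y₀)
    (hA : L < 2 * A * (y₀ * (y₀ + 2))) (hA0 : 0 < A) (hAY : A * (Y - y₀) ^ 2 < 1)
    (p : HypSpace n) {z : HypSpace n → ℝ}
    (hzc : ContinuousOn z {x | coshDist p x ≤ 1 + Y})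
    (hz2 : ContDiffOn ℝ 2 z {x | coshDist p x < 1 + Y})
    (hlap : ∀ x, coshDist p x < 1 + Y → 0 ≤ laplacian k z x + k * L * z x)
    (hin : ∀ x, coshDist p x = 1 + y₀ → z x ≤ 0) (hout : ∀ x, coshDist p x = 1 + Y → z x ≤ 0) :
    ∀ x, 1 + y₀ < coshDist p x → coshDist p x < 1 + Y → z x ≤ 0 := by
  set D := {x | 1 + y₀ < coshDist p x ∧ coshDist p x < 1 + Y} with hD
  have hDo : IsOpen D := (isOpen_lt continuous_const (continuous_coshDist p)).inter
    (isOpen_lt (continuous_coshDist p) continuous_const)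
  have hcl : closure D ⊆ {x | 1 + y₀ ≤ coshDist p x ∧ coshDist p x ≤ 1 + Y} :=
    closure_minimal (fun x hx => ⟨hx.1.le, hx.2.le⟩)
      ((isClosed_le continuous_const (continuous_coshDist p)).inter
        (isClosed_le (continuous_coshDist p) continuous_const))
  have hKc : IsCompact (closure D) :=
    (isCompact_coshDist_le p (1 + Y)).of_isClosed_subset isClosed_closure fun x hx => (hcl hx).2
  -- On the annulus 1 - A(y - y₀)² is a positive strict supersolution: `hAY` gives positivity, and
  -- `hA` lets the second-order term beat L.
  have hd1 : ∀ y, HasDerivAt (fun y : ℝ => 1 - A * (y - y₀) ^ 2) (-(2 * A) * (y - y₀)) y := by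
    intro y
    refine (((((hasDerivAt_id y).sub_const y₀).pow 2).const_mul A).const_sub 1).congr_deriv ?_
    simp; ring
  have hd2 : ∀ y, HasDerivAt (fun y : ℝ => -(2 * A) * (y - y₀)) (-(2 * A)) y := fun y => by
    simpa using ((hasDerivAt_id y).sub_const y₀).const_mul (-(2 * A))
  have hV := contDiff_radial hd1 hd2 continuous_const p
  intro x h1 h2
  refine nonpos_of_comparison hk hDo hKc hV.continuous.continuousOn
    (hzc.mono fun x hx => (hcl hx).2) hV.contDiffOn (hz2.mono fun x hx => hx.2)
    (fun x hx => ?_) (fun x hx => ?_) (k * L) (fun x hx hzx => ?_) x (subset_closure ⟨h1, h2⟩)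
  · have h3 := (hcl hx).1
    have h4 := (hcl hx).2
    have h5 : A * (coshDist p x - 1 - y₀) ^ 2 ≤ A * (Y - y₀) ^ 2 :=
      mul_le_mul_of_nonneg_left (pow_le_pow_left₀ (by linarith) (by linarith) 2) hA0.le
    linarith
  · have hxc := hcl (frontier_subset_closure hx)
    rcases hxc.1.eq_or_lt with h | h
    · exact hin x h.symm
    rcases hxc.2.eq_or_lt with h' | h'
    · exact hout x h'
    · exact absurd (show x ∈ interior D by rw [hDo.interior_eq]; exact ⟨h, h'⟩) hx.2
  · have h3 := hlap x hx.2
    have hx1 : y₀ < coshDist p x - 1 := by linarith [hx.1]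
    have hx2 : coshDist p x - 1 < Y := by linarith [hx.2]
    have hVpos : 0 ≤ 1 - A * (coshDist p x - 1 - y₀) ^ 2 := by
      have h5 : A * (coshDist p x - 1 - y₀) ^ 2 ≤ A * (Y - y₀) ^ 2 :=
      mul_le_mul_of_nonneg_left (pow_le_pow_left₀ (by linarith) (by linarith) 2) hA0.le
      linarith
    refine lt_of_lt_of_le (mul_neg_of_pos_of_neg hzx ?_) (mul_nonneg hVpos h3)
    rw [laplacian_radial hk hd1 hd2 continuous_const]
    set y := coshDist p x - 1
    have hy : 0 < y := hy₀.trans hx1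
    have h4 : y₀ * (y₀ + 2) ≤ y * (y + 2) := by nlinarith
    have h5 : 2 * A * (y₀ * (y₀ + 2)) ≤ 2 * A * (y * (y + 2)) := by gcongr
    have h6 : 0 ≤ n * (1 + y) * (2 * A * (y - y₀)) :=
      mul_nonneg (by positivity) (mul_nonneg (by positivity) (by linarith))
    have h7 : 0 ≤ L * (A * (y - y₀) ^ 2) := by positivity
    have h8 : y * (y + 2) * -(2 * A) + n * (1 + y) * (-(2 * A) * (y - y₀)) +
        L * (1 - A * (y - y₀) ^ 2) < 0 := by nlinarith
    have := mul_neg_of_pos_of_neg hk h8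
    linarith

/-- A positive supersolution on the ball vanishes on the boundary sphere. -/
theorem eq_zero_on_sphere (hn : 0 < n) {k : ℝ} (hk : 0 < k) {L Y : ℝ} (hL : 0 < L)
    (hY : 0 < Y) (h0 : sol n L Y = 0)
    (p : HypSpace n) {u : HypSpace n → ℝ} (huc : ContinuousOn u {x | coshDist p x ≤ 1 + Y})
    (hu : ContDiffOn ℝ 2 u {x | coshDist p x < 1 + Y})
    (hupos : ∀ x, coshDist p x ≤ 1 + Y → 0 ≤ u x)
    (hlap : ∀ x, coshDist p x < 1 + Y → laplacian k u x + k * L * u x ≤ 0) :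
    ∀ x, coshDist p x = 1 + Y → u x = 0 := by
  have hn' : (0 : ℝ) < n := Nat.cast_pos.2 hn
  set D := {x | coshDist p x < 1 + Y} with hD
  have hDo : IsOpen D := isOpen_coshDist_lt p _
  have hp : p ∈ D := by
    show coshDist p p < 1 + Y
    rw [coshDist_self]; linarith
  have hv := contDiff_radialSol hn L p
  have hvzero : ∀ x, coshDist p x = 1 + Y → radialSol L p x = 0 := fun x hx => by
    rw [radialSol, hx, add_sub_cancel_left, h0]
  -- The bound t ≤ u(p) costs nothing, since the radial solution is 1 at p.
  have hTc : IsCompact {t : ℝ | t ∈ Icc 0 (u p) ∧ ∀ x ∈ D, t * radialSol L p x ≤ u x} := by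
    refine isCompact_Icc.inter_right (t := {t : ℝ | ∀ x ∈ D, t * radialSol L p x ≤ u x}) ?_
    simp only [ofPred_forall]
    exact isClosed_iInter fun x => isClosed_iInter fun _ =>
      isClosed_le (by fun_prop) continuous_const
  obtain ⟨t, ht, hmax⟩ := hTc.exists_isGreatest
    ⟨0, ⟨le_rfl, hupos p (le_of_lt hp)⟩, fun x hx => by
      rw [zero_mul]; exact hupos x (le_of_lt hx)⟩
  have ht0 : 0 ≤ t := ht.1.1
  set w : HypSpace n → ℝ := fun x => 1 * u x + (-t) * radialSol L p x with hw
  have hw0 : ∀ x ∈ D, 0 ≤ w x := fun x hx => by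
    have := ht.2 x hx
    simp only [hw]; linarith
  have hw2 : ContDiffOn ℝ 2 w D :=
    (contDiffOn_const.mul hu).add (contDiffOn_const.mul hv.contDiffOn)
  have hwc : ContinuousOn w {x | coshDist p x ≤ 1 + Y} :=
    (continuousOn_const.mul huc).add (continuousOn_const.mul hv.continuous.continuousOn)
  have hwlap : ∀ x ∈ D, laplacian k w x + k * L * w x ≤ 0 := fun x hx => by
    rw [laplacian_lincomb hk (hu.contDiffAt (hDo.mem_nhds hx)) hv.contDiffAt]
    have h1 := hlap x hx
    have h2 := laplacian_radialSol hn hk L p x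
    simp only [hw]
    linear_combination h1 - t * h2
  by_cases hz : ∃ z ∈ D, w z = 0
  · obtain ⟨z, hz, hwz⟩ := hz
    -- Here Δw ≤ -kLw ≤ 0, so w vanishes identically, and by density also on the sphere, where the
    -- radial solution is 0.
    have hzero := eq_zero_of_superharmonic hk hDo (convex_coshDist_lt p _).isPreconnected hw2 hw0
      (fun x hx => by
        have h1 := hwlap x hx
        have h2 : 0 ≤ k * L * w x := mul_nonneg (by positivity) (hw0 x hx)
        linarith) hz hwz
    intro x hx
    have hEq : EqOn w 0 {x | coshDist p x ≤ 1 + Y} :=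
      EqOn.of_subset_closure (fun x hx => hzero x hx) hwc continuousOn_const
        (fun x hx => le_of_lt (show coshDist p x < 1 + Y from hx)) (coshDist_le_subset_closure p (by linarith))
    have h1 : w x = 0 := hEq (show coshDist p x ≤ 1 + Y from hx.le)
    simp only [hw, hvzero x hx] at h1
    linarith
  · exfalso
    push Not at hz
    have hwpos : ∀ x ∈ D, 0 < w x := fun x hx => (hw0 x hx).lt_of_ne (hz x hx).symm
    -- W₀ bounds y(y + 2) from below on the annulus, since η ≤ Y/2; the bound η ≤ 1/(A + 1) makes
    -- Aη² < 1. These are the hypotheses of `nonpos_on_annulus`.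
    set W₀ := Y / 2 * (Y / 2 + 2) with hW₀
    have hW₀pos : 0 < W₀ := by positivity
    set A := L / W₀ with hA
    have hA0 : 0 < A := by positivity
    set η := min (Y / 2) (1 / (A + 1)) with hη
    have hη0 : 0 < η := lt_min (by positivity) (by positivity)
    have hη1 : η ≤ Y / 2 := min_le_left _ _
    have hη2 : η * (A + 1) ≤ 1 := (le_div_iff₀ (by positivity)).1 (min_le_right _ _)
    have hsubD : ∀ x ∈ {x | coshDist p x ≤ 1 + (Y - η)}, coshDist p x < 1 + Y := fun x hx => by
      have : coshDist p x ≤ 1 + (Y - η) := hx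
      linarith
    obtain ⟨m, hm, hwm⟩ := (isCompact_coshDist_le p (1 + (Y - η))).exists_forall_le'
      (hwc.mono fun x hx => (hsubD x hx).le) (a := 0) fun x hx => hwpos x (hsubD x hx)
    obtain ⟨B, hB⟩ := (isCompact_coshDist_le p (1 + Y)).exists_bound_of_continuousOn
      hv.continuous.continuousOn
    have hB0 : 0 < max B 1 := lt_of_lt_of_le one_pos (le_max_right _ _)
    set ε := m / max B 1 with hε
    have hε0 : 0 < ε := div_pos hm hB0
    have hcore : ∀ x, coshDist p x ≤ 1 + (Y - η) → ε * radialSol L p x ≤ w x := by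
      intro x hx
      refine le_trans ?_ (hwm x hx)
      have h1 := (le_abs_self _).trans ((hB x (show coshDist p x ≤ 1 + Y by linarith)).trans
        (le_max_left B 1))
      calc ε * radialSol L p x ≤ ε * max B 1 := by gcongr
        _ = m := by rw [hε, div_mul_cancel₀ _ hB0.ne']
    have hann := nonpos_on_annulus (y₀ := Y - η) (A := A) (Y := Y) hk hL (by linarith) (by
        have h1 : W₀ ≤ (Y - η) * (Y - η + 2) := by
          rw [hW₀]; nlinarith
        have h2 : 2 * A * W₀ ≤ 2 * A * ((Y - η) * (Y - η + 2)) := by gcongr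
        have h3 : A * W₀ = L := by rw [hA]; field_simp
        linarith) hA0 (by
        rw [sub_sub_cancel]
        have : η < 1 := by nlinarith
        nlinarith) p (z := fun x => ε * radialSol L p x + (-1) * w x)
      ((continuousOn_const.mul hv.continuous.continuousOn).add (continuousOn_const.mul hwc))
      ((contDiffOn_const.mul hv.contDiffOn).add (contDiffOn_const.mul hw2))
      (fun x hx => by
        rw [laplacian_lincomb hk hv.contDiffAt (hw2.contDiffAt (hDo.mem_nhds hx))]
        have h1 := hwlap x hx
        have h2 := laplacian_radialSol hn hk L p x
        linear_combination h1 - ε * h2)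
      (fun x hx => by have := hcore x hx.le; linarith)
      (fun x hx => by
        simp only [hw, hvzero x hx]
        have := hupos x hx.le
        linarith)
    have hall : ∀ x ∈ D, ε * radialSol L p x ≤ w x := by
      intro x hx
      rcases le_or_gt (coshDist p x) (1 + (Y - η)) with h | h
      · exact hcore x h
      · have := hann x h hx
        linarith
    have hmem : ∀ x ∈ D, (t + ε) * radialSol L p x ≤ u x := fun x hx => by
      have := hall x hx
      simp only [hw] at this
      linarith
    -- Now t + ε is admissible, against the maximality of t.
    have := hmax ⟨⟨by positivity, by simpa [radialSol_self] using hmem p hp⟩, hmem⟩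
    linarith

/-- An open set with `C²` boundary is regular open. -/
theorem interior_closure_subset {Ω : Set (HypSpace n)} (hb : HasC2Boundary Ω) :
    interior (closure Ω) ⊆ Ω := by
  intro q hq
  by_contra hqΩ
  obtain ⟨φ, hφ, hd, hiff⟩ := hb q ⟨interior_subset hq, fun h => hqΩ (interior_subset h)⟩
  have hcont : ∀ᶠ x in 𝓝 q, ContinuousAt φ x :=
    (hφ.eventually (by simp)).mono fun x hx => hx.continuousAt
  -- Where φ > 0 there are no points of Ω, yet every point near q is a limit of such points. So φ
  -- has a local maximum at q, against dφ ≠ 0.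
  have hle : ∀ᶠ x in 𝓝 q, φ x ≤ 0 := by
    filter_upwards [hcont, hiff.eventually_nhds, mem_interior_iff_mem_nhds.1 hq] with x h1 h2 h3
    by_contra! h4
    obtain ⟨y, ⟨h5, h6⟩, h7⟩ := mem_closure_iff_nhds.1 h3 _ ((h1.eventually (lt_mem_nhds h4)).and h2)
    have := h6.1 h7
    linarith
  have h0 : 0 ≤ φ q := by
    by_contra! h
    exact hqΩ (hiff.self_of_nhds.2 h)
  have hmax : IsLocalMax φ q := by
    filter_upwards [hle] with x hx using hx.trans h0
  exact hd hmax.fderiv_eq_zero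

end HypSpace

namespace HypSpace

open Filter Set

open RadialODE

variable {n : ℕ}

/-- If the closure of the domain contains the closed ball, then the domain is the ball. -/
theorem eq_ball_of_closedBall_subset_closure (hn : 0 < n) {k : ℝ} (hk : 0 < k) {L Y : ℝ}
    (hL : 0 < L) (hY : 0 < Y) (h0 : sol n L Y = 0)
    {Ω : Set (HypSpace n)} (hΩ : IsOpen Ω) (hconn : IsPreconnected Ω) {u : HypSpace n → ℝ}
    (hu : ContDiffOn ℝ 2 u Ω) (hupos : ∀ x ∈ Ω, 0 < u x)
    (hlap : ∀ x ∈ Ω, laplacian k u x + k * L * u x ≤ 0) (hb : HasC2Boundary Ω)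
    (hzero : ∀ q ∈ frontier Ω, u q = 0)
    (hcont : ∀ q ∈ frontier Ω, ContinuousWithinAt u (closure Ω) q) (p : HypSpace n)
    (hp : {x | coshDist p x ≤ 1 + Y} ⊆ closure Ω) : Ω = {x | coshDist p x < 1 + Y} := by
  have hsub : {x | coshDist p x < 1 + Y} ⊆ Ω := by
    refine Subset.trans (interior_maximal (fun x hx => hp ?_) (isOpen_coshDist_lt p _))
      (interior_closure_subset hb)
    exact le_of_lt (show coshDist p x < 1 + Y from hx)
  have hcases : ∀ x ∈ closure Ω, x ∈ Ω ∨ x ∈ frontier Ω := fun x hx => by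
    by_cases h : x ∈ Ω
    · exact Or.inl h
    · exact Or.inr ⟨hx, fun hi => h (interior_subset hi)⟩
  have hucl : ContinuousOn u (closure Ω) := fun x hx => by
    rcases hcases x hx with h | h
    · exact (hu.continuousOn.continuousAt (hΩ.mem_nhds h)).continuousWithinAt
    · exact hcont x h
  have hnonneg : ∀ x ∈ closure Ω, 0 ≤ u x := fun x hx => by
    rcases hcases x hx with h | h
    · exact (hupos x h).le
    · exact (hzero x h).ge
  have hsphere := eq_zero_on_sphere hn hk hL hY h0 p (hucl.mono hp) (hu.mono hsub)
    (fun x hx => hnonneg x (hp hx)) fun x hx => hlap x (hsub hx)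
  refine Subset.antisymm ?_ hsub
  -- As u > 0 in Ω and u = 0 on the sphere, Ω lies in the disjoint union of the open ball and the
  -- exterior, and it meets the ball.
  refine IsPreconnected.subset_left_of_subset_union (isOpen_coshDist_lt p _)
    (isOpen_lt continuous_const (continuous_coshDist p)) (v := {x | 1 + Y < coshDist p x}) ?_ ?_
    ?_ hconn
  · rw [Set.disjoint_left]
    intro x h1 h2
    exact lt_asymm (show coshDist p x < 1 + Y from h1) h2
  · intro x hx
    rcases lt_trichotomy (coshDist p x) (1 + Y) with h | h | h
    · exact Or.inl h
    · exact absurd (hsphere x h) (hupos x hx).ne'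
    · exact Or.inr h
  · have hpp : p ∈ {x | coshDist p x < 1 + Y} := by
      show coshDist p p < 1 + Y
      rw [coshDist_self]; linarith
    exact ⟨p, hsub hpp, hpp⟩

end HypSpace

theorem lemma2p1 (n : ℕ) (hn : 2 ≤ n) (k : ℝ) (hk : 0 < k) (lam : ℝ)
    (hlam : ((n : ℝ) - 1) ^ 2 * k / 4 < lam) :
    ∃ R : ℝ, 0 < R ∧
      (∀ (r : ℝ) (o : HypSpace n), 0 < r →
        (HypSpace.IsFirstDirichletEigenvalue k (HypSpace.geodesicBall k o r) lam ↔ r = R)) ∧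
      ∀ (Ω : Set (HypSpace n)) (f : ℝ → ℝ) (u : HypSpace n → ℝ),
        IsOpen Ω → IsConnected Ω →
        (∀ t : ℝ, 0 < t → lam * t ≤ f t) →
        ContDiffOn ℝ 2 u Ω →
        (∀ x ∈ Ω, 0 < u x) →
        (∀ x ∈ Ω, HypSpace.laplacian k u x + f (u x) = 0) →
        (∀ p : HypSpace n, ¬ HypSpace.closedGeodesicBall k p R ⊆ Ω) ∧
        (∀ α : ℝ, α < 0 → HypSpace.HasC2Boundary Ω →
          HypSpace.OverdeterminedBoundary k Ω u α →
          (∀ p : HypSpace n, ¬ HypSpace.closedGeodesicBall k p R ⊆ closure Ω) ∨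
            ∃ p : HypSpace n, Ω = HypSpace.geodesicBall k p R) := by
  have hn0 : 0 < n := by omega
  have hn' : (0 : ℝ) < n := Nat.cast_pos.2 hn0
  have hL' : ((n : ℝ) - 1) ^ 2 / 4 < lam / k := by
    rw [lt_div_iff₀ hk]; linarith
  have hL : 0 < lam / k := lt_of_le_of_lt (by positivity) hL'
  have hkL : k * (lam / k) = lam := mul_div_cancel₀ lam hk.ne'
  obtain ⟨y, hy, hsol⟩ := RadialODE.exists_nonpos hn' hL hL'
  obtain ⟨Y, hY, -, h0, hpos⟩ := RadialODE.exists_first_zero hn' hy hsol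
  have hsk : 0 < √k := Real.sqrt_pos.2 hk
  have hR : 0 < Real.arcosh (1 + Y) / √k := div_pos (Real.arcosh_pos (by linarith)) hsk
  have hcR : Real.cosh (√k * (Real.arcosh (1 + Y) / √k)) = 1 + Y := by
    rw [mul_div_cancel₀ _ hsk.ne', Real.cosh_arcosh (by linarith)]
  refine ⟨Real.arcosh (1 + Y) / √k, hR, fun r o hr => ?_, ?_⟩
  · have hkr : 0 < √k * r := mul_pos hsk hr
    have hc : 0 < Real.cosh (√k * r) - 1 := by
      have := Real.one_lt_cosh.2 hkr.ne'
      linarith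
    have h := HypSpace.isFirstDirichletEigenvalue_iff hn0 hk hL hY h0 hpos hc o
    rw [add_sub_cancel, hkL] at h
    rw [HypSpace.geodesicBall_eq hk o hr.le, h, eq_div_iff hsk.ne', mul_comm r]
    constructor
    · intro he
      rw [← he, add_sub_cancel, Real.arcosh_cosh hkr.le]
    · intro he
      rw [he, Real.cosh_arcosh (by linarith), add_sub_cancel_left]
  · intro Ω f u hΩ hconn hf hu hupos hlap
    have hsup : ∀ x ∈ Ω, HypSpace.laplacian k u x + k * (lam / k) * u x ≤ 0 := fun x hx => by
      have h1 := hlap x hx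
      have h2 := hf _ (hupos x hx)
      rw [hkL]; linarith
    refine ⟨fun p => ?_, fun α _ hb hod => ?_⟩
    · rw [HypSpace.closedGeodesicBall_eq hk p hR.le, hcR]
      exact HypSpace.not_closedBall_subset hn0 hk hL hY h0 hpos hΩ hu hupos hsup p
    · by_cases hcl : ∀ p : HypSpace n,
        ¬ HypSpace.closedGeodesicBall k p (Real.arcosh (1 + Y) / √k) ⊆ closure Ω
      · exact Or.inl hcl
      right
      push Not at hcl
      obtain ⟨p, hp⟩ := hcl
      refine ⟨p, ?_⟩
      rw [HypSpace.closedGeodesicBall_eq hk p hR.le, hcR] at hp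
      rw [HypSpace.geodesicBall_eq hk p hR.le, hcR]
      exact HypSpace.eq_ball_of_closedBall_subset_closure hn0 hk hL hY h0 hΩ
        hconn.isPreconnected hu hupos hsup hb (fun q hq => (hod q hq).1)
        (fun q hq => (hod q hq).2.1.continuousWithinAt) p hp
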